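/- Let $X$ be a real or complex Banach space. Write $\mathcal F(Y,Z)$ for the normed space (operator norm) of continuous finite-rank operators $Y\to Z$, $\mathcal F(Y)=\mathcal F(Y,Y)$, $\widehat\otimes$ for the completed projective tensor product and $\|\cdot\|_\wedge$ for its norm, and let $\mathcal A(X)$ be the Banach algebra of approximable operators on $X$, i.e. the operator-norm closure of $\mathcal F(X)$ in the bounded operators on $X$. A Banach algebra $\mathcal A$ is called amenable if for every Banach $\mathcal A$-bimodule $E$ (a Banach space with bounded bilinear, commuting left and right actions of $\mathcal A$) every continuous derivation $D:\mathcal A\to E^*$ is inner, where $(a\cdot f)(x)=f(x\cdot a)$ and $(f\cdot a)(x)=f(a\cdot x)$. For finite-dimensional normed spaces $Y,Z$, an element $\Delta\in\mathcal F(Z,Y)\widehat\otimes\mathcal F(Y,Z)$ is a generalized diagonal for $\mathcal F(Y)$ if $W\Delta=\Delta W$ and $\pi(\Delta)W=W$ for every $W\in\mathcal F(Y)$, where $W(U\otimes V)=WU\otimes V$, $(U\otimes V)W=U\otimes VW$ and $\pi(U\otimes V)=UV$. Suppose that $\mathcal A(X)$ contains a bounded net of projections $(P_\alpha)_{\alpha\in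 A}$ such that $P_\alpha x\to x$ for every $x\in X$ and $P_\alpha^*x^*\to x^*$ in norm for every $x^*\in X^*$. Let $X_\alpha=P_\alpha(X)$ with the norm of $X$; these spaces are finite-dimensional. Then $\mathcal A(X)$ is amenable if and only if there is a constant $K>0$ such that for every $\alpha\in A$ there exists $\beta\in A$ such that $\mathcal F(X_\beta,X_\alpha)\widehat\otimes\mathcal F(X_\alpha,X_\beta)$ contains a generalized diagonal $\Delta$ for $\mathcal F(X_\alpha)$ with $\|\Delta\|_\wedge\le K$. -/

import Mathlib

open scoped TensorProduct Topology

namespace GenDiag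

noncomputable section

universe u v

/-! ### Amenability of Banach algebras -/

/-- A Banach `A`-bimodule structure on a Banach space `E`: bounded bilinear actions
`a · x = left a x` and `x · a = right a x`, each associative, that commute with each other.
The algebra `A` need not have a unit. -/
structure BanachBimodule (𝕜 : Type v) [RCLike 𝕜] (A : Type u) [NonUnitalNormedRing A]
    [NormedSpace 𝕜 A] (E : Type*) [NormedAddCommGroup E] [NormedSpace 𝕜 E] where
  left : A →L[𝕜] E →L[𝕜] E
  right : A →L[𝕜] E →L[𝕜] E
  left_mul : ∀ (a b : A) (x : E), left (a * b) x = left a (left b x)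
  right_mul : ∀ (a b : A) (x : E), right (a * b) x = right b (right a x)
  left_right : ∀ (a b : A) (x : E), left a (right b x) = right b (left a x)

namespace BanachBimodule

variable {𝕜 : Type v} [RCLike 𝕜] {A : Type u} [NonUnitalNormedRing A] [NormedSpace 𝕜 A]
  {E : Type*} [NormedAddCommGroup E] [NormedSpace 𝕜 E]

/-- The left action on the dual module: `(a · f)(x) = f (x · a)`. -/
def dualLeft (M : BanachBimodule 𝕜 A E) (a : A) (f : StrongDual 𝕜 E) : StrongDual 𝕜 E :=
  f.comp (M.right a)

/-- The right action on the dual module: `(f · a)(x) = f (a · x)`. -/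
def dualRight (M : BanachBimodule 𝕜 A E) (f : StrongDual 𝕜 E) (a : A) : StrongDual 𝕜 E :=
  f.comp (M.left a)

end BanachBimodule

/-- A Banach algebra `A` is amenable if, for every Banach `A`-bimodule `E`, every continuous
derivation from `A` to the dual module of `E` is inner. -/
def IsAmenable (𝕜 : Type v) [RCLike 𝕜] (A : Type u) [NonUnitalNormedRing A]
    [NormedSpace 𝕜 A] : Prop :=
  ∀ (E : Type (max u v)) [NormedAddCommGroup E] [NormedSpace 𝕜 E] [CompleteSpace E]
    (M : BanachBimodule 𝕜 A E) (D : A →L[𝕜] StrongDual 𝕜 E),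
    (∀ a b : A, D (a * b) = M.dualRight (D a) b + M.dualLeft a (D b)) →
      ∃ f : StrongDual 𝕜 E, ∀ a : A, D a = M.dualLeft a f - M.dualRight f a

/-! ### The projective tensor product of two normed spaces -/

section Projective

variable (𝕜 : Type*) [RCLike 𝕜] (E F : Type*) [NormedAddCommGroup E] [NormedSpace 𝕜 E]
  [NormedAddCommGroup F] [NormedSpace 𝕜 F]

/-- The algebraic tensor product `E ⊗ F`, to be endowed with the projective norm. -/
def AlgTensor : Type _ := E ⊗[𝕜] F

instance : AddCommGroup (AlgTensor 𝕜 E F) := inferInstanceAs (AddCommGroup (E ⊗[𝕜] F))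

instance : Module 𝕜 (AlgTensor 𝕜 E F) := inferInstanceAs (Module 𝕜 (E ⊗[𝕜] F))

/-- The identification of `E ⊗ F` with its normed copy. -/
def toAlg : E ⊗[𝕜] F ≃ₗ[𝕜] AlgTensor 𝕜 E F := LinearEquiv.refl 𝕜 (E ⊗[𝕜] F)

variable {E F}

/-- The tensor `∑ xᵢ ⊗ yᵢ` represented by a finite list of pairs `(xᵢ, yᵢ)`. -/
def tensorSum (l : List (E × F)) : AlgTensor 𝕜 E F :=
  (l.map fun p => toAlg 𝕜 E F (p.1 ⊗ₜ[𝕜] p.2)).sum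

/-- The cost `∑ ‖xᵢ‖ ‖yᵢ‖` of a finite list of pairs `(xᵢ, yᵢ)`. -/
def tensorCost (l : List (E × F)) : ℝ := (l.map fun p => ‖p.1‖ * ‖p.2‖).sum

theorem tensorCost_nonneg (l : List (E × F)) : 0 ≤ tensorCost l := by
  refine List.sum_nonneg fun a ha => ?_
  obtain ⟨p, -, rfl⟩ := List.mem_map.1 ha
  positivity

theorem exists_tensorSum (t : AlgTensor 𝕜 E F) : ∃ l : List (E × F), tensorSum 𝕜 l = t := by
  obtain ⟨t, rfl⟩ := (toAlg 𝕜 E F).surjective t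
  induction t using TensorProduct.induction_on with
  | zero => exact ⟨[], by simp [tensorSum]⟩
  | tmul x y => exact ⟨[(x, y)], by simp [tensorSum]⟩
  | add s t hs ht =>
    obtain ⟨l, hl⟩ := hs
    obtain ⟨m, hm⟩ := ht
    exact ⟨l ++ m, by simp [tensorSum, ← hl, ← hm]⟩

/-- The projective norm: the infimum of `∑ ‖xᵢ‖ ‖yᵢ‖` over all finite representations
`t = ∑ xᵢ ⊗ yᵢ`. -/
def projNorm (t : AlgTensor 𝕜 E F) : ℝ :=
  ⨅ l : {l : List (E × F) // tensorSum 𝕜 l = t}, tensorCost l.1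

theorem projNorm_le (l : List (E × F)) : projNorm 𝕜 (tensorSum 𝕜 l) ≤ tensorCost l :=
  ciInf_le (f := fun m : {m : List (E × F) // tensorSum 𝕜 m = tensorSum 𝕜 l} => tensorCost m.1)
    ⟨0, by rintro _ ⟨m, rfl⟩; exact tensorCost_nonneg m.1⟩ ⟨l, rfl⟩

theorem le_projNorm {t : AlgTensor 𝕜 E F} {c : ℝ}
    (h : ∀ l : List (E × F), tensorSum 𝕜 l = t → c ≤ tensorCost l) : c ≤ projNorm 𝕜 t := by
  obtain ⟨l, hl⟩ := exists_tensorSum 𝕜 t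
  have : Nonempty {l : List (E × F) // tensorSum 𝕜 l = t} := ⟨⟨l, hl⟩⟩
  exact le_ciInf fun m => h m.1 m.2

theorem le_mul_projNorm {t : AlgTensor 𝕜 E F} {c d : ℝ} (hd : 0 ≤ d)
    (h : ∀ l : List (E × F), tensorSum 𝕜 l = t → c ≤ d * tensorCost l) :
    c ≤ d * projNorm 𝕜 t := by
  obtain ⟨l, hl⟩ := exists_tensorSum 𝕜 t
  have : Nonempty {l : List (E × F) // tensorSum 𝕜 l = t} := ⟨⟨l, hl⟩⟩
  rw [projNorm, Real.mul_iInf_of_nonneg hd]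
  exact le_ciInf fun m => h m.1 m.2

theorem projNorm_add_le (s t : AlgTensor 𝕜 E F) :
    projNorm 𝕜 (s + t) ≤ projNorm 𝕜 s + projNorm 𝕜 t := by
  rw [← sub_le_iff_le_add]
  refine le_projNorm 𝕜 fun l hl => ?_
  rw [sub_le_comm]
  refine le_projNorm 𝕜 fun m hm => ?_
  rw [sub_le_iff_le_add]
  have h : tensorSum 𝕜 (l ++ m) = s + t := by simp [tensorSum, ← hl, ← hm]
  rw [← h]
  refine (projNorm_le 𝕜 (l ++ m)).trans (le_of_eq ?_)
  simp [tensorCost, add_comm]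

theorem projNorm_smul_le (c : 𝕜) (t : AlgTensor 𝕜 E F) :
    projNorm 𝕜 (c • t) ≤ ‖c‖ * projNorm 𝕜 t := by
  refine le_mul_projNorm 𝕜 (norm_nonneg c) fun l hl => ?_
  have h1 : tensorSum 𝕜 (l.map fun p => (c • p.1, p.2)) = c • t := by
    rw [← hl, tensorSum, tensorSum, List.smul_sum]
    simp [Function.comp_def, ← TensorProduct.smul_tmul']
  have h2 : tensorCost (l.map fun p => (c • p.1, p.2)) = ‖c‖ * tensorCost l := by
    simp [tensorCost, Function.comp_def, norm_smul, mul_assoc, List.sum_map_mul_left]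
  rw [← h1, ← h2]
  exact projNorm_le 𝕜 _

variable (E F) in
/-- The projective norm as a seminorm on the algebraic tensor product. -/
def projSeminorm : Seminorm 𝕜 (AlgTensor 𝕜 E F) :=
  .ofSMulLE (projNorm 𝕜)
    (le_antisymm (projNorm_le 𝕜 ([] : List (E × F)))
      (le_projNorm 𝕜 fun l _ => tensorCost_nonneg l))
    (projNorm_add_le 𝕜) (projNorm_smul_le 𝕜)

instance : SeminormedAddCommGroup (AlgTensor 𝕜 E F) :=
  AddGroupSeminorm.toSeminormedAddCommGroup (projSeminorm 𝕜 E F).toAddGroupSeminorm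

theorem norm_eq_projNorm (t : AlgTensor 𝕜 E F) : ‖t‖ = projNorm 𝕜 t := rfl

instance : NormedSpace 𝕜 (AlgTensor 𝕜 E F) := ⟨projNorm_smul_le 𝕜⟩

variable (E F) in
/-- The projective tensor product of `E` and `F`: the completion of the algebraic tensor product
for the projective norm. -/
abbrev ProjTensor : Type _ := UniformSpace.Completion (AlgTensor 𝕜 E F)

/-- The elementary tensor `x ⊗ y` in the projective tensor product. -/
def ptmul (x : E) (y : F) : ProjTensor 𝕜 E F :=
  (toAlg 𝕜 E F (x ⊗ₜ[𝕜] y) : AlgTensor 𝕜 E F)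

variable {𝕜} {G : Type*} [NormedAddCommGroup G] [NormedSpace 𝕜 G]

/-- The bounded linear map on the algebraic tensor product given by a bounded bilinear map. -/
def algLift (B : E →L[𝕜] F →L[𝕜] G) : AlgTensor 𝕜 E F →L[𝕜] G :=
  LinearMap.mkContinuous
    ((TensorProduct.lift ((ContinuousLinearMap.coeLM 𝕜).comp B.toLinearMap)).comp
      (toAlg 𝕜 E F).symm.toLinearMap)
    ‖B‖ (by
      intro t
      refine le_mul_projNorm 𝕜 (norm_nonneg B) ?_
      rintro l rfl
      unfold tensorSum tensorCost
      induction l with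
      | nil => simp
      | cons p l ih =>
        simp only [List.map_cons, List.sum_cons, map_add, mul_add]
        refine (norm_add_le _ _).trans (add_le_add ?_ ih)
        simpa [mul_assoc] using B.le_opNorm₂ p.1 p.2)

theorem algLift_tmul (B : E →L[𝕜] F →L[𝕜] G) (x : E) (y : F) :
    algLift B (toAlg 𝕜 E F (x ⊗ₜ[𝕜] y)) = B x y := by
  change TensorProduct.lift ((ContinuousLinearMap.coeLM 𝕜).comp B.toLinearMap) (x ⊗ₜ[𝕜] y) = _
  simp

/-- The bounded linear map on the projective tensor product determined by a bounded bilinear map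
`B` with values in a Banach space, `x ⊗ y ↦ B x y`. -/
def projLift [CompleteSpace G] (B : E →L[𝕜] F →L[𝕜] G) : ProjTensor 𝕜 E F →L[𝕜] G :=
  (algLift B).extend UniformSpace.Completion.toComplL

theorem projLift_coe [CompleteSpace G] (B : E →L[𝕜] F →L[𝕜] G) (t : AlgTensor 𝕜 E F) :
    projLift B (t : ProjTensor 𝕜 E F) = algLift B t :=
  (algLift B).extend_eq (e := UniformSpace.Completion.toComplL)
    UniformSpace.Completion.denseRange_coe
    (UniformSpace.Completion.isUniformInducing_coe _) t

theorem projLift_ptmul [CompleteSpace G] (B : E →L[𝕜] F →L[𝕜] G) (x : E) (y : F) :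
    projLift B (ptmul 𝕜 x y) = B x y := by
  rw [ptmul, projLift_coe, algLift_tmul]

variable (𝕜 E F) in
/-- The canonical bounded bilinear map `(x, y) ↦ x ⊗ y` into the projective tensor product. -/
def ptmulL : E →L[𝕜] F →L[𝕜] ProjTensor 𝕜 E F :=
  LinearMap.mkContinuous₂
    ((TensorProduct.mk 𝕜 E F).compr₂
      ((UniformSpace.Completion.toComplL :
          AlgTensor 𝕜 E F →L[𝕜] ProjTensor 𝕜 E F).toLinearMap.comp
        (toAlg 𝕜 E F).toLinearMap)) 1 (by
      intro x y
      have h := projNorm_le 𝕜 [(x, y)]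
      simpa [tensorSum, tensorCost, ← norm_eq_projNorm] using h)

theorem ptmulL_apply (x : E) (y : F) : ptmulL 𝕜 E F x y = ptmul 𝕜 x y := by
  simp [ptmulL, ptmul]

variable {E' F' : Type*} [NormedAddCommGroup E'] [NormedSpace 𝕜 E']
  [NormedAddCommGroup F'] [NormedSpace 𝕜 F']

/-- The tensor product `S ⊗ T` of two bounded operators, `x ⊗ y ↦ S x ⊗ T y`. -/
def projMap (S : E →L[𝕜] E') (T : F →L[𝕜] F') : ProjTensor 𝕜 E F →L[𝕜] ProjTensor 𝕜 E' F' :=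
  projLift ((ptmulL 𝕜 E' F').bilinearComp S T)

theorem projMap_ptmul (S : E →L[𝕜] E') (T : F →L[𝕜] F') (x : E) (y : F) :
    projMap S T (ptmul 𝕜 x y) = ptmul 𝕜 (S x) (T y) := by
  unfold projMap
  rw [projLift_ptmul, ContinuousLinearMap.bilinearComp_apply, ptmulL_apply]

end Projective

/-! ### Finite-rank and approximable operators -/

section Operators

variable (𝕜 : Type*) [RCLike 𝕜]

/-- The normed space `F(X, Y)` of continuous finite-rank operators, with the operator norm. -/
def finiteRank (X Y : Type*) [NormedAddCommGroup X] [NormedSpace 𝕜 X]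
    [NormedAddCommGroup Y] [NormedSpace 𝕜 Y] : Submodule 𝕜 (X →L[𝕜] Y) where
  carrier := {T | FiniteDimensional 𝕜 (LinearMap.range T.toLinearMap)}
  zero_mem' := by
    change FiniteDimensional 𝕜 (LinearMap.range (0 : X →ₗ[𝕜] Y))
    rw [LinearMap.range_zero]
    infer_instance
  add_mem' := by
    intro S T hS hT
    have : FiniteDimensional 𝕜 (LinearMap.range S.toLinearMap) := hS
    have : FiniteDimensional 𝕜 (LinearMap.range T.toLinearMap) := hT
    exact Submodule.finiteDimensional_of_le
      (LinearMap.range_add_le S.toLinearMap T.toLinearMap)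
  smul_mem' := by
    intro c T hT
    have : FiniteDimensional 𝕜 (LinearMap.range T.toLinearMap) := hT
    refine Submodule.finiteDimensional_of_le (S₂ := LinearMap.range T.toLinearMap) ?_
    rintro _ ⟨x, rfl⟩
    exact ⟨c • x, by simp⟩

variable {𝕜} {X Y Z : Type*} [NormedAddCommGroup X] [NormedSpace 𝕜 X]
  [NormedAddCommGroup Y] [NormedSpace 𝕜 Y] [NormedAddCommGroup Z] [NormedSpace 𝕜 Z]

theorem comp_mem_finiteRank_left (W : Y →L[𝕜] Z) {T : X →L[𝕜] Y} (hT : T ∈ finiteRank 𝕜 X Y) :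
    W.comp T ∈ finiteRank 𝕜 X Z := by
  have : FiniteDimensional 𝕜 (LinearMap.range T.toLinearMap) := hT
  change FiniteDimensional 𝕜 (LinearMap.range (W.toLinearMap.comp T.toLinearMap))
  rw [LinearMap.range_comp]
  infer_instance

theorem comp_mem_finiteRank_right {T : Y →L[𝕜] Z} (hT : T ∈ finiteRank 𝕜 Y Z) (W : X →L[𝕜] Y) :
    T.comp W ∈ finiteRank 𝕜 X Z := by
  have : FiniteDimensional 𝕜 (LinearMap.range T.toLinearMap) := hT
  exact Submodule.finiteDimensional_of_le
    (LinearMap.range_comp_le_range W.toLinearMap T.toLinearMap)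

/-- Composition on the left, `T ↦ W T`, from `F(X, Y)` to `F(X, Z)`. -/
def postcomp (W : Y →L[𝕜] Z) : finiteRank 𝕜 X Y →L[𝕜] finiteRank 𝕜 X Z :=
  ((ContinuousLinearMap.compL 𝕜 X Y Z W).comp (finiteRank 𝕜 X Y).subtypeL).codRestrict
    (finiteRank 𝕜 X Z) fun T => comp_mem_finiteRank_left W T.2

/-- Composition on the right, `T ↦ T W`, from `F(Y, Z)` to `F(X, Z)`. -/
def precomp (W : X →L[𝕜] Y) : finiteRank 𝕜 Y Z →L[𝕜] finiteRank 𝕜 X Z :=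
  (((ContinuousLinearMap.compL 𝕜 X Y Z).flip W).comp (finiteRank 𝕜 Y Z).subtypeL).codRestrict
    (finiteRank 𝕜 X Z) fun T => comp_mem_finiteRank_right T.2 W

variable (𝕜 X) in
/-- The algebra `F(X)` of continuous finite-rank operators on `X`. -/
def finiteRankAlg : NonUnitalSubalgebra 𝕜 (X →L[𝕜] X) :=
  { finiteRank 𝕜 X X with
    mul_mem' := fun {S _} _ hT => comp_mem_finiteRank_left S hT }

variable (𝕜 X) in
/-- The algebra `A(X)` of approximable operators on `X`: the closure of `F(X)` in the operator
norm. -/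
def approximable : NonUnitalSubalgebra 𝕜 (X →L[𝕜] X) := (finiteRankAlg 𝕜 X).topologicalClosure

instance : NormedSpace 𝕜 (approximable 𝕜 X) := ⟨fun c T => norm_smul_le c T.1⟩

variable (𝕜 X) in
/-- The projections in `A(X)`. -/
abbrev ApproxProj : Type _ := {p : approximable 𝕜 X // IsIdempotentElem p}

namespace ApproxProj

/-- A projection in `A(X)`, as an operator on `X`. -/
def op (p : ApproxProj 𝕜 X) : X →L[𝕜] X := p.1.1

/-- The range of a projection in `A(X)`, a subspace of `X` with the norm of `X`. -/
def rg (p : ApproxProj 𝕜 X) : Submodule 𝕜 X := LinearMap.range p.op.toLinearMap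

theorem op_apply_of_mem (p : ApproxProj 𝕜 X) {x : X} (hx : x ∈ p.rg) : p.op x = x := by
  obtain ⟨y, rfl⟩ := hx
  have h : p.op * p.op = p.op := congrArg Subtype.val p.2
  exact congrArg (fun T : X →L[𝕜] X => T y) h

/-- The range of an approximable projection on a Banach space is finite-dimensional. -/
instance finiteDimensional_rg [CompleteSpace X] (p : ApproxProj 𝕜 X) :
    FiniteDimensional 𝕜 p.rg := by
  have hfin : ∀ T ∈ finiteRankAlg 𝕜 X, IsCompactOperator T := by
    intro T hT
    have : FiniteDimensional 𝕜 (LinearMap.range T.toLinearMap) := hT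
    have : ProperSpace (LinearMap.range T.toLinearMap) := FiniteDimensional.proper 𝕜 _
    have h1 : IsCompactOperator
        (T.codRestrict (LinearMap.range T.toLinearMap) fun x => ⟨x, rfl⟩) :=
      isCompactOperator_of_locallyCompactSpace_dom _
    exact h1.clm_comp (LinearMap.range T.toLinearMap).subtypeL
  have hcomp : IsCompactOperator p.op :=
    closure_minimal hfin isClosed_setOfPred_isCompactOperator p.1.2
  have hcl : IsClosed (p.rg : Set X) := by
    have : (p.rg : Set X) = {x | p.op x = x} :=
      Set.ext fun x => ⟨fun hx => p.op_apply_of_mem hx, fun hx => ⟨x, hx⟩⟩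
    rw [this]
    exact isClosed_eq p.op.continuous continuous_id
  obtain ⟨K, hK, hsub⟩ := hcomp.image_closedBall_subset_compact (f := p.op.toLinearMap) 1
  refine FiniteDimensional.of_isCompact_closedBall₀ 𝕜 zero_lt_one ?_
  have hemb : Topology.IsClosedEmbedding ((↑) : p.rg → X) := hcl.isClosedEmbedding_subtypeVal
  refine (hemb.isCompact_preimage hK).of_isClosed_subset Metric.isClosed_closedBall ?_
  intro x hx
  refine hsub ⟨x, ?_, p.op_apply_of_mem x.2⟩
  simpa using hx

end ApproxProj

/-! ### Generalized diagonals -/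

variable (𝕜 X Y) in
/-- The product map `π`, `U ⊗ V ↦ U V`, on the projective tensor product of `F(Y, X)` and
`F(X, Y)`. Its values are regarded as operators on `X`. -/
def prodMap [CompleteSpace X] :
    ProjTensor 𝕜 (finiteRank 𝕜 Y X) (finiteRank 𝕜 X Y) →L[𝕜] (X →L[𝕜] X) :=
  projLift ((ContinuousLinearMap.compL 𝕜 X Y X).bilinearComp
    (finiteRank 𝕜 Y X).subtypeL (finiteRank 𝕜 X Y).subtypeL)

/-- The left action of operators on `X`, `W (U ⊗ V) = W U ⊗ V`. -/
def leftAct (W : X →L[𝕜] X) (Δ : ProjTensor 𝕜 (finiteRank 𝕜 Y X) (finiteRank 𝕜 X Y)) :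
    ProjTensor 𝕜 (finiteRank 𝕜 Y X) (finiteRank 𝕜 X Y) :=
  projMap (postcomp W) (ContinuousLinearMap.id 𝕜 _) Δ

/-- The right action of operators on `X`, `(U ⊗ V) W = U ⊗ V W`. -/
def rightAct (Δ : ProjTensor 𝕜 (finiteRank 𝕜 Y X) (finiteRank 𝕜 X Y)) (W : X →L[𝕜] X) :
    ProjTensor 𝕜 (finiteRank 𝕜 Y X) (finiteRank 𝕜 X Y) :=
  projMap (ContinuousLinearMap.id 𝕜 _) (precomp W) Δ

/-- For finite-dimensional `X` and `Y` and a subalgebra `𝒜` of `F(X)` (here all operators on `X`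
have finite rank), `Δ` is a generalized diagonal for `𝒜` if `W Δ = Δ W` and `π(Δ) W = W` for all
`W` in `𝒜`. -/
def IsGeneralizedDiagonal [FiniteDimensional 𝕜 X] [FiniteDimensional 𝕜 Y]
    (𝒜 : NonUnitalSubalgebra 𝕜 (X →L[𝕜] X))
    (Δ : ProjTensor 𝕜 (finiteRank 𝕜 Y X) (finiteRank 𝕜 X Y)) : Prop :=
  haveI : CompleteSpace X := FiniteDimensional.complete 𝕜 X
  (∀ W ∈ 𝒜, leftAct W Δ = rightAct Δ W) ∧
    ∀ W ∈ 𝒜, (prodMap 𝕜 X Y Δ).comp W = W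

end Operators

end

end GenDiag

/-!
A generalized diagonal `Δ = ∑ U ⊗ V` for `F(X_α)` turns a derivation `D` into the functional
`∑ U · D V`, which is controlled by `‖Δ‖` and implements `D` on `F(X_α)`. As the norms are bounded,
these functionals have a weak-* limit `φ`, and `D - ad φ` vanishes wherever it is tested against a
product with an element of the algebra. A derivation of this kind is again inner: a functional
implementing it is a weak-* limit of its values on the approximate identity `(P_α)`.

Conversely, an amenable algebra with a bounded approximate identity has a virtual diagonal, a
functional on the bounded bilinear forms. Compressed to the dual of `F(X, X_α) ⊗̂ F(X_α, X)`, it is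
fixed by an averaging operator whose values are central tensors, so by Hahn-Banach some central
tensor of controlled norm has nonzero product. The product of a central tensor is a scalar multiple
of the identity, hence cutting the middle space `X` down to `X_β` for large `β` and rescaling gives
a generalized diagonal.
-/

open Filter

namespace GenDiag

noncomputable section

set_option maxSynthPendingDepth 3

universe u v

section BoundedFamilies

variable {𝕜 : Type*} [RCLike 𝕜] {V W : Type*} [SeminormedAddCommGroup V] [NormedSpace 𝕜 V]
  [NormedAddCommGroup W] [NormedSpace 𝕜 W] {ι : Type*} {L : ι → V →L[𝕜] W} {C : ℝ}

theorem tendsto_apply_of_norm_le (hC : ∀ i, ‖L i‖ ≤ C) {l : Filter ι} {v : ι → V} {v₀ : V}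
    {w : W} (hv : Tendsto v l (𝓝 v₀)) (hL : Tendsto (fun i => L i v₀) l (𝓝 w)) :
    Tendsto (fun i => L i (v i)) l (𝓝 w) := by
  have hdiff : Tendsto (fun i => L i (v i - v₀)) l (𝓝 0) := by
    refine squeeze_zero_norm (fun i => (L i).le_of_opNorm_le (hC i) (v i - v₀)) ?_
    simpa using (hv.sub_const v₀).norm.const_mul C
  simpa using hdiff.add hL

theorem tendsto_apply_of_mem_closure_span (hC : ∀ i, ‖L i‖ ≤ C) {L₀ : V →L[𝕜] W} {l : Filter ι}
    {s : Set V} (hs : ∀ v ∈ s, Tendsto (fun i => L i v) l (𝓝 (L₀ v))) {v : V}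
    (hv : v ∈ closure (Submodule.span 𝕜 s : Set V)) :
    Tendsto (fun i => L i v) l (𝓝 (L₀ v)) := by
  have hbdd : ∃ C, ∀ i, ‖L i‖ ≤ C := ⟨C, hC⟩
  have hequi : Equicontinuous ((↑) ∘ L) := ((NormedSpace.equicontinuous_TFAE L).out 5 1).1 hbdd
  refine closure_minimal (fun v hv => ?_) (hequi.isClosed_setOfPred_tendsto L₀.continuous) hv
  change Tendsto (fun i => L i v) l (𝓝 (L₀ v))
  replace hv : v ∈ Submodule.span 𝕜 s := hv
  induction hv using Submodule.span_induction with
  | zero => simpa only [map_zero] using tendsto_const_nhds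
  | mem v hv => exact hs v hv
  | add v w _ _ hv hw => simpa only [map_add] using hv.add hw
  | smul c v _ hv => simpa only [map_smul] using hv.const_smul c

theorem exists_weakStar_limit (U : Ultrafilter ι) (f : ι → StrongDual 𝕜 V)
    (hC : ∀ i, ‖f i‖ ≤ C) : ∃ g : StrongDual 𝕜 V, ∀ x, Tendsto (fun i => f i x) U (𝓝 (g x)) := by
  obtain ⟨g, -, hg⟩ := (WeakDual.isCompact_closedBall (0 : StrongDual 𝕜 V) C).ultrafilter_le_nhds
    (U.map fun i => StrongDual.toWeakDual (f i)) (by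
      rw [le_principal_iff]
      exact mem_map.2 (Eventually.of_forall fun i => by simpa using hC i))
  exact ⟨WeakDual.toStrongDual g, fun x => ((WeakDual.eval_continuous x).tendsto g).comp hg⟩

end BoundedFamilies

section HahnBanach

variable {𝕜 : Type*} [RCLike 𝕜] {V : Type*} [SeminormedAddCommGroup V] [NormedSpace 𝕜 V]

theorem exists_extension_norm_le_inv (N : Submodule 𝕜 V) (τ : StrongDual 𝕜 V) {K : ℝ} (hK : 0 < K)
    (h : ∀ v ∈ N, τ v = 1 → K < ‖v‖) :
    ∃ φ : StrongDual 𝕜 V, ‖φ‖ ≤ K⁻¹ ∧ ∀ v ∈ N, φ v = τ v := by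
  obtain ⟨φ, hφ, hnorm⟩ := exists_extension_norm_eq N (τ.comp N.subtypeL)
  refine ⟨φ, ?_, fun v hv => hφ ⟨v, hv⟩⟩
  rw [hnorm]
  refine ContinuousLinearMap.opNorm_le_bound _ (by positivity) fun v => ?_
  change ‖τ v‖ ≤ K⁻¹ * ‖(v : V)‖
  obtain hv | hv := eq_or_ne (τ v) 0
  · rw [hv, norm_zero]
    positivity
  · have hlt := h ((τ v)⁻¹ • (v : V)) (N.smul_mem _ v.2) (by simp [hv])
    rw [norm_smul, norm_inv, lt_inv_mul_iff₀ (norm_pos_iff.2 hv)] at hlt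
    rw [le_inv_mul_iff₀ hK, mul_comm]
    exact hlt.le

theorem exists_mem_norm_le_of_bidual (N : Submodule 𝕜 V) (Φ : StrongDual 𝕜 (StrongDual 𝕜 V))
    (hN : ∀ φ : StrongDual 𝕜 V, (∀ v ∈ N, φ v = 0) → Φ φ = 0) {τ : StrongDual 𝕜 V}
    (hτ : Φ τ = 1) {K : ℝ} (hK : ‖Φ‖ < K) : ∃ v ∈ N, τ v = 1 ∧ ‖v‖ ≤ K := by
  by_contra! h
  have hK₀ : 0 < K := (norm_nonneg Φ).trans_lt hK
  obtain ⟨φ, hφ, hφτ⟩ := exists_extension_norm_le_inv N τ hK₀ h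
  have hΦφ : Φ φ = 1 := by
    rw [← hτ, ← sub_eq_zero, ← map_sub]
    exact hN _ fun v hv => by simp [hφτ v hv]
  have : (1 : ℝ) < 1 := calc
    1 = ‖Φ φ‖ := by rw [hΦφ, norm_one]
    _ ≤ ‖Φ‖ * K⁻¹ := Φ.le_opNorm_of_le hφ
    _ < K * K⁻¹ := by gcongr
    _ = 1 := mul_inv_cancel₀ hK₀.ne'
  exact this.false

end HahnBanach

section ApproximateIdentity

variable {A : Type*} [NonUnitalNormedRing A] {ι : Type*}

/-- A bounded two-sided approximate identity of a normed algebra, indexed by an arbitrary filter. -/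
structure IsBoundedApproxIdentity (l : Filter ι) (e : ι → A) : Prop where
  bounded : ∃ C, ∀ i, ‖e i‖ ≤ C
  tendsto_mul_left : ∀ a, Tendsto (fun i => e i * a) l (𝓝 a)
  tendsto_mul_right : ∀ a, Tendsto (fun i => a * e i) l (𝓝 a)

namespace IsBoundedApproxIdentity

variable {l l' : Filter ι} {e : ι → A}

theorem mono (he : IsBoundedApproxIdentity l e) (h : l' ≤ l) : IsBoundedApproxIdentity l' e :=
  ⟨he.bounded, fun a => (he.tendsto_mul_left a).mono_left h,
    fun a => (he.tendsto_mul_right a).mono_left h⟩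

theorem tendsto_mul_mul (he : IsBoundedApproxIdentity l e) (a : A) :
    Tendsto (fun i => e i * a * e i) l (𝓝 a) := by
  obtain ⟨C, hC⟩ := he.bounded
  have hdiff : Tendsto (fun i => e i * (a * e i - a)) l (𝓝 0) :=
    isBoundedUnder_le_mul_tendsto_zero (isBoundedUnder_of ⟨C, hC⟩) <| by
      simpa using (he.tendsto_mul_right a).sub_const a
  simpa [mul_sub, mul_assoc] using hdiff.add (he.tendsto_mul_left a)

end IsBoundedApproxIdentity

end ApproximateIdentity

namespace BanachBimodule

section Derivations

variable {𝕜 : Type*} [RCLike 𝕜] {A : Type*} [NonUnitalNormedRing A] [NormedSpace 𝕜 A]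
  {E : Type*} [NormedAddCommGroup E] [NormedSpace 𝕜 E]

/-- Derivations from `A` to the dual of a bimodule. -/
def IsDerivation (M : BanachBimodule 𝕜 A E) (D : A →L[𝕜] StrongDual 𝕜 E) : Prop :=
  ∀ a b, D (a * b) = M.dualRight (D a) b + M.dualLeft a (D b)

/-- The inner derivation `a ↦ a · φ - φ · a`. -/
def innerDer (M : BanachBimodule 𝕜 A E) (φ : StrongDual 𝕜 E) : A →L[𝕜] StrongDual 𝕜 E :=
  (ContinuousLinearMap.compL 𝕜 E E 𝕜 φ).comp (M.right - M.left)

variable {M : BanachBimodule 𝕜 A E} {D D' : A →L[𝕜] StrongDual 𝕜 E}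

theorem innerDer_apply (φ : StrongDual 𝕜 E) (a : A) (x : E) :
    M.innerDer φ a x = φ (M.right a x) - φ (M.left a x) :=
  map_sub φ _ _

theorem innerDer_eq_dualLeft_sub_dualRight (φ : StrongDual 𝕜 E) (a : A) :
    M.innerDer φ a = M.dualLeft a φ - M.dualRight φ a :=
  ContinuousLinearMap.ext (innerDer_apply φ a)

theorem isDerivation_innerDer (φ : StrongDual 𝕜 E) : M.IsDerivation (M.innerDer φ) := by
  intro a b
  ext x
  simp only [dualLeft, dualRight, add_apply, ContinuousLinearMap.comp_apply, innerDer_apply,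
    M.right_mul, M.left_mul, M.left_right]
  ring

theorem IsDerivation.apply_mul (hD : M.IsDerivation D) (a b : A) (x : E) :
    D (a * b) x = D a (M.left b x) + D b (M.right a x) :=
  DFunLike.congr_fun (hD a b) x

theorem IsDerivation.sub (hD : M.IsDerivation D) (hD' : M.IsDerivation D') :
    M.IsDerivation (D - D') := by
  intro a b
  ext x
  simp only [dualLeft, dualRight, sub_apply, add_apply, ContinuousLinearMap.comp_apply,
    hD.apply_mul, hD'.apply_mul]
  ring

variable {ι : Type*} {l : Filter ι} [l.NeBot] {e : ι → A}

theorem IsDerivation.exists_eq_innerDer_of_apply_right_eq_zero (hD : M.IsDerivation D)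
    (he : IsBoundedApproxIdentity l e) (h₀ : ∀ a b x, D a (M.right b x) = 0) :
    ∃ φ, D = M.innerDer φ := by
  obtain ⟨C, hC⟩ := he.bounded
  obtain ⟨φ, hφ⟩ := exists_weakStar_limit (Ultrafilter.of l) (fun i => D (e i))
    fun i => D.le_opNorm_of_le (hC i)
  replace he := he.mono (Ultrafilter.of_le l)
  refine ⟨-φ, ?_⟩
  ext a x
  have hright : φ (M.right a x) = 0 :=
    tendsto_nhds_unique (hφ (M.right a x)) (by simp only [h₀, tendsto_const_nhds])
  have hleft : D a x = φ (M.left a x) := by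
    refine tendsto_nhds_unique ?_ (hφ (M.left a x))
    have := ((D.flip x).continuous.tendsto a).comp (he.tendsto_mul_left a)
    simpa [Function.comp_def, hD.apply_mul, h₀] using this
  simp [innerDer_apply, hright, hleft]

theorem IsDerivation.exists_eq_innerDer_of_apply_right (hD : M.IsDerivation D)
    (he : IsBoundedApproxIdentity l e) {φ : StrongDual 𝕜 E}
    (hφ : ∀ a b x, D a (M.right b x) = M.innerDer φ a (M.right b x)) :
    ∃ ψ, D = M.innerDer ψ := by
  obtain ⟨ψ, hψ⟩ := (hD.sub (isDerivation_innerDer φ)).exists_eq_innerDer_of_apply_right_eq_zero he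
    fun a b x => sub_eq_zero.2 (hφ a b x)
  refine ⟨ψ + φ, ?_⟩
  ext a x
  have h : D a x - M.innerDer φ a x = M.innerDer ψ a x :=
    DFunLike.congr_fun (DFunLike.congr_fun hψ a) x
  simp only [innerDer_apply, add_apply] at h ⊢
  linear_combination h

theorem IsDerivation.exists_eq_innerDer_of_corners (hD : M.IsDerivation D)
    (he : IsBoundedApproxIdentity l e) {f : ι → StrongDual 𝕜 E} {C : ℝ} (hf : ∀ i, ‖f i‖ ≤ C)
    (hcomm : ∀ i a x, M.innerDer (f i) (e i * a * e i) x = D (e i * a * e i) (M.right (e i) x)) :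
    ∃ φ, D = M.innerDer φ := by
  obtain ⟨φ, hφ⟩ := exists_weakStar_limit (Ultrafilter.of l) f hf
  refine hD.exists_eq_innerDer_of_apply_right he (φ := φ) fun a b x => ?_
  replace he := he.mono (Ultrafilter.of_le l)
  have happly : ∀ L : A →L[𝕜] E,
      Tendsto (fun i => f i (L (e i * a * e i))) (Ultrafilter.of l) (𝓝 (φ (L a))) := fun L =>
    tendsto_apply_of_norm_le hf ((L.continuous.tendsto a).comp (he.tendsto_mul_mul a)) (hφ (L a))
  have hinner : Tendsto (fun i => M.innerDer (f i) (e i * a * e i) (M.right b x))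
      (Ultrafilter.of l) (𝓝 (M.innerDer φ a (M.right b x))) := by
    simp only [innerDer_apply]
    exact (happly (M.right.flip _)).sub (happly (M.left.flip _))
  have hcont : Continuous fun p : A × A => D p.1 (M.right p.2 x) := by fun_prop
  have hD : Tendsto (fun i => D (e i * a * e i) (M.right (b * e i) x)) (Ultrafilter.of l)
      (𝓝 (D a (M.right b x))) :=
    (hcont.tendsto (a, b)).comp ((he.tendsto_mul_mul a).prodMk_nhds (he.tendsto_mul_right b))
  exact tendsto_nhds_unique hD (by simpa only [hcomm, M.right_mul] using hinner)

end Derivations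

section Quotient

variable {𝕜 : Type v} [RCLike 𝕜] {A : Type u} [NonUnitalNormedRing A] [NormedSpace 𝕜 A]
  {E : Type*} [NormedAddCommGroup E] [NormedSpace 𝕜 E]

/-- The bimodule of cosets of a closed sub-bimodule. -/
def quotient (M : BanachBimodule 𝕜 A E) (N : Submodule 𝕜 E) [IsClosed (N : Set E)]
    (hleft : ∀ a, ∀ x ∈ N, M.left a x ∈ N) (hright : ∀ a, ∀ x ∈ N, M.right a x ∈ N) :
    BanachBimodule 𝕜 A (E ⧸ N) where
  left := (N.liftQL ((ContinuousLinearMap.compL 𝕜 A E (E ⧸ N) N.mkQL).comp M.left.flip)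
    fun x hx => ContinuousLinearMap.ext fun a =>
      (Submodule.Quotient.mk_eq_zero N).2 (hleft a x hx)).flip
  right := (N.liftQL ((ContinuousLinearMap.compL 𝕜 A E (E ⧸ N) N.mkQL).comp M.right.flip)
    fun x hx => ContinuousLinearMap.ext fun a =>
      (Submodule.Quotient.mk_eq_zero N).2 (hright a x hx)).flip
  left_mul := by
    rintro a b ⟨x⟩
    exact congrArg N.mkQL (M.left_mul a b x)
  right_mul := by
    rintro a b ⟨x⟩
    exact congrArg N.mkQL (M.right_mul a b x)
  left_right := by
    rintro a b ⟨x⟩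
    exact congrArg N.mkQL (M.left_right a b x)

end Quotient

end BanachBimodule

section CentralExtension

open BanachBimodule

variable {𝕜 : Type v} [RCLike 𝕜] {A : Type u} [NonUnitalNormedRing A] [NormedSpace 𝕜 A]
  {E : Type (max u v)} [NormedAddCommGroup E] [NormedSpace 𝕜 E] [CompleteSpace E]

/-- `innerDer φ` vanishes on `N`, hence is a derivation into the dual of `E ⧸ N`. -/
theorem IsAmenable.exists_central_extension (hA : IsAmenable 𝕜 A) (M : BanachBimodule 𝕜 A E)
    (N : Submodule 𝕜 E) [IsClosed (N : Set E)] (hleft : ∀ a, ∀ x ∈ N, M.left a x ∈ N)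
    (hright : ∀ a, ∀ x ∈ N, M.right a x ∈ N) (φ : StrongDual 𝕜 E)
    (hφ : ∀ a, ∀ x ∈ N, φ (M.right a x) = φ (M.left a x)) :
    ∃ ψ : StrongDual 𝕜 E, (∀ x ∈ N, ψ x = φ x) ∧ ∀ a x, ψ (M.right a x) = ψ (M.left a x) := by
  let D : A →L[𝕜] StrongDual 𝕜 (E ⧸ N) := (N.liftQL (M.innerDer φ).flip fun x hx =>
    ContinuousLinearMap.ext fun a => by
      simpa [innerDer_apply, sub_eq_zero] using hφ a x hx).flip
  obtain ⟨f, hf⟩ := hA (E ⧸ N) (M.quotient N hleft hright) D fun a b =>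
    ContinuousLinearMap.ext fun q => by
      obtain ⟨x, rfl⟩ := N.mkQ_surjective q
      exact (isDerivation_innerDer φ).apply_mul a b x
  refine ⟨φ - f.comp N.mkQL, fun x hx => ?_, fun a x => ?_⟩
  · have : N.mkQ x = 0 := (Submodule.Quotient.mk_eq_zero N).2 hx
    simp [this]
  · have h : φ (M.right a x) - φ (M.left a x) =
        f (N.mkQL (M.right a x)) - f (N.mkQL (M.left a x)) :=
      (innerDer_apply φ a x).symm.trans (DFunLike.congr_fun (hf a) (N.mkQL x))
    simp only [sub_apply, ContinuousLinearMap.comp_apply]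
    linear_combination h

end CentralExtension

section VirtualDiagonal

open BanachBimodule

section BalancedForms

variable {𝕜 : Type v} [RCLike 𝕜] {A : Type u} [NonUnitalNormedRing A] [NormedSpace 𝕜 A]

variable (𝕜 A) in
/-- The bilinear forms that vanish on the tensors `x a ⊗ y - x ⊗ a y`. -/
def balancedForms : Submodule 𝕜 (A →L[𝕜] A →L[𝕜] 𝕜) where
  carrier := {B | ∀ x a y, B (x * a) y = B x (a * y)}
  zero_mem' _ _ _ := rfl
  add_mem' hB hB' x a y := congrArg₂ (· + ·) (hB x a y) (hB' x a y)
  smul_mem' c _ hB x a y := congrArg (c • ·) (hB x a y)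

instance : IsClosed (balancedForms 𝕜 A : Set (A →L[𝕜] A →L[𝕜] 𝕜)) := by
  change IsClosed {B : A →L[𝕜] A →L[𝕜] 𝕜 | ∀ x a y, B (x * a) y = B x (a * y)}
  simp only [Set.ofPred_forall]
  exact isClosed_iInter fun x => isClosed_iInter fun a => isClosed_iInter fun y =>
    isClosed_eq (by fun_prop) (by fun_prop)

variable {ι : Type*} {e : ι → A}

theorem IsBoundedApproxIdentity.tendsto_commutator_of_mem_balancedForms {l : Filter ι}
    (he : IsBoundedApproxIdentity l e) (a : A) {B : A →L[𝕜] A →L[𝕜] 𝕜}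
    (hB : B ∈ balancedForms 𝕜 A) :
    Tendsto (fun i => B (a * e i) (e i) - B (e i) (e i * a)) l (𝓝 0) := by
  obtain ⟨C, hC⟩ := he.bounded
  have hcomm : Tendsto (fun i => a * e i - e i * a) l (𝓝 0) := by
    simpa using (he.tendsto_mul_right a).sub (he.tendsto_mul_left a)
  have hleft : Tendsto (fun i => B (a * e i - e i * a) (e i)) l (𝓝 0) :=
    tendsto_apply_of_norm_le (L := fun i => B.flip (e i))
      (fun i => B.flip.le_opNorm_of_le (hC i)) hcomm
      (by simp only [map_zero, tendsto_const_nhds])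
  have hright : Tendsto (fun i => B (e i) (a * e i - e i * a)) l (𝓝 0) :=
    tendsto_apply_of_norm_le (L := fun i => B (e i)) (fun i => B.le_opNorm_of_le (hC i)) hcomm
      (by simp only [map_zero, tendsto_const_nhds])
  have hsplit : ∀ i, B (a * e i - e i * a) (e i) + B (e i) (a * e i - e i * a) =
      B (a * e i) (e i) - B (e i) (e i * a) := fun i => by
    simp only [map_sub, sub_apply, hB (e i) a (e i)]
    ring
  simpa only [hsplit, add_zero] using hleft.add hright

theorem exists_weakStar_limit_apply_apply (U : Ultrafilter ι) (he : IsBoundedApproxIdentity U e) :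
    ∃ M : StrongDual 𝕜 (A →L[𝕜] A →L[𝕜] 𝕜), ∀ B, Tendsto (fun i => B (e i) (e i)) U (𝓝 (M B)) := by
  obtain ⟨C, hC⟩ := he.bounded
  refine exists_weakStar_limit U (C := C * C) (fun i => (ContinuousLinearMap.apply 𝕜 𝕜 (e i)).comp
    (ContinuousLinearMap.apply 𝕜 (A →L[𝕜] 𝕜) (e i))) fun i => ?_
  have hC₀ : 0 ≤ C := (norm_nonneg _).trans (hC i)
  refine ContinuousLinearMap.opNorm_le_bound _ (by positivity) fun B => ?_
  calc ‖B (e i) (e i)‖ ≤ ‖B‖ * ‖e i‖ * ‖e i‖ := B.le_opNorm₂ _ _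
    _ ≤ ‖B‖ * C * C := by gcongr <;> exact hC i
    _ = C * C * ‖B‖ := by ring

end BalancedForms

section BilinearForms

variable (𝕜 : Type v) [RCLike 𝕜] (A : Type u) [NonUnitalNormedRing A] [NormedSpace 𝕜 A]
  [IsScalarTower 𝕜 A A] [SMulCommClass 𝕜 A A]

/-- The bimodule of bounded bilinear forms on `A`, with `(a · B)(x, y) = B (x, y a)` and
`(B · a)(x, y) = B (a x, y)`. It plays the role of the dual of the projective tensor square of `A`,
so that a functional on it stands for an element of the bidual. -/
def bilinForms : BanachBimodule 𝕜 A (A →L[𝕜] A →L[𝕜] 𝕜) where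
  left := (ContinuousLinearMap.compL 𝕜 A (A →L[𝕜] 𝕜) (A →L[𝕜] 𝕜)).comp
    ((ContinuousLinearMap.compL 𝕜 A A 𝕜).flip.comp (ContinuousLinearMap.mul 𝕜 A).flip)
  right := (ContinuousLinearMap.compL 𝕜 A A (A →L[𝕜] 𝕜)).flip.comp (ContinuousLinearMap.mul 𝕜 A)
  left_mul a b B := by
    ext x y
    simp [mul_assoc]
  right_mul a b B := by
    ext x y
    simp [mul_assoc]
  left_right _ _ _ := rfl

variable {𝕜 A}

theorem bilinForms_left_apply (a x y : A) (B : A →L[𝕜] A →L[𝕜] 𝕜) :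
    (bilinForms 𝕜 A).left a B x y = B x (y * a) := rfl

theorem bilinForms_right_apply (a x y : A) (B : A →L[𝕜] A →L[𝕜] 𝕜) :
    (bilinForms 𝕜 A).right a B x y = B (a * x) y := rfl

/-- The bilinear form `(x, y) ↦ ψ (x y)`, that is, `ψ` composed with the product map. -/
def mulForm (ψ : StrongDual 𝕜 A) : A →L[𝕜] A →L[𝕜] 𝕜 :=
  (ContinuousLinearMap.compL 𝕜 A A 𝕜 ψ).comp (ContinuousLinearMap.mul 𝕜 A)

theorem left_mem_balancedForms (a : A) {B : A →L[𝕜] A →L[𝕜] 𝕜} (hB : B ∈ balancedForms 𝕜 A) :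
    (bilinForms 𝕜 A).left a B ∈ balancedForms 𝕜 A := fun x c y => by
  rw [bilinForms_left_apply, bilinForms_left_apply, hB, mul_assoc]

theorem right_mem_balancedForms (a : A) {B : A →L[𝕜] A →L[𝕜] 𝕜} (hB : B ∈ balancedForms 𝕜 A) :
    (bilinForms 𝕜 A).right a B ∈ balancedForms 𝕜 A := fun x c y => by
  rw [bilinForms_right_apply, bilinForms_right_apply, ← mul_assoc, hB]

theorem mulForm_mem_balancedForms (ψ : StrongDual 𝕜 A) : mulForm ψ ∈ balancedForms 𝕜 A :=
  fun x a y => congrArg ψ (mul_assoc x a y)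

end BilinearForms

variable {𝕜 : Type v} [RCLike 𝕜] {A : Type u} [NonUnitalNormedRing A] [NormedSpace 𝕜 A]
  [IsScalarTower 𝕜 A A] [SMulCommClass 𝕜 A A]

/-- Virtual diagonals, as functionals on bounded bilinear forms: the first condition reads
`a · M = M · a`, the second one `π** (M) · a = a`. -/
structure IsVirtualDiagonal (M : StrongDual 𝕜 (A →L[𝕜] A →L[𝕜] 𝕜)) : Prop where
  central : ∀ a B, M ((bilinForms 𝕜 A).right a B) = M ((bilinForms 𝕜 A).left a B)
  map_right_mulForm : ∀ a ψ, M ((bilinForms 𝕜 A).right a (mulForm ψ)) = ψ a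

theorem IsAmenable.exists_isVirtualDiagonal (hA : IsAmenable 𝕜 A) {ι : Type*} {e : ι → A}
    {l : Filter ι} [l.NeBot] (he : IsBoundedApproxIdentity l e) :
    ∃ M : StrongDual 𝕜 (A →L[𝕜] A →L[𝕜] 𝕜), IsVirtualDiagonal M := by
  replace he := he.mono (Ultrafilter.of_le l)
  obtain ⟨C, hC⟩ := he.bounded
  obtain ⟨M₀, hM₀⟩ := exists_weakStar_limit_apply_apply (𝕜 := 𝕜) (Ultrafilter.of l) he
  have hcentral : ∀ a, ∀ B ∈ balancedForms 𝕜 A,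
      M₀ ((bilinForms 𝕜 A).right a B) = M₀ ((bilinForms 𝕜 A).left a B) := fun a B hB =>
    sub_eq_zero.1 (tendsto_nhds_unique ((hM₀ _).sub (hM₀ _))
      (he.tendsto_commutator_of_mem_balancedForms a hB))
  have hmul : ∀ a (ψ : StrongDual 𝕜 A), M₀ ((bilinForms 𝕜 A).right a (mulForm ψ)) = ψ a :=
    fun a ψ => tendsto_nhds_unique (hM₀ _) <|
      tendsto_apply_of_norm_le (L := fun i => (mulForm ψ).flip (e i))
        (fun i => (mulForm ψ).flip.le_opNorm_of_le (hC i)) (he.tendsto_mul_right a)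
        ((ψ.continuous.tendsto a).comp (he.tendsto_mul_right a))
  obtain ⟨M, hM, hMcentral⟩ := hA.exists_central_extension (bilinForms 𝕜 A) (balancedForms 𝕜 A)
    (fun a B => left_mem_balancedForms a) (fun a B => right_mem_balancedForms a) M₀ hcentral
  refine ⟨M, hMcentral, fun a ψ => ?_⟩
  rw [hM _ (right_mem_balancedForms a (mulForm_mem_balancedForms ψ)), hmul]

end VirtualDiagonal

section Projective

variable {𝕜 : Type*} [RCLike 𝕜] {E F E' F' G : Type*} [NormedAddCommGroup E] [NormedSpace 𝕜 E]
  [NormedAddCommGroup F] [NormedSpace 𝕜 F] [NormedAddCommGroup E'] [NormedSpace 𝕜 E']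
  [NormedAddCommGroup F'] [NormedSpace 𝕜 F'] [NormedAddCommGroup G] [NormedSpace 𝕜 G]

variable (𝕜 E F) in
theorem dense_span_ptmul :
    Dense (Submodule.span 𝕜 {t : ProjTensor 𝕜 E F | ∃ x y, ptmul 𝕜 x y = t} :
      Set (ProjTensor 𝕜 E F)) := by
  refine UniformSpace.Completion.denseRange_coe.mono ?_
  rintro _ ⟨s, rfl⟩
  obtain ⟨s, rfl⟩ := (toAlg 𝕜 E F).surjective s
  induction s using TensorProduct.induction_on with
  | zero =>
    rw [map_zero, UniformSpace.Completion.coe_zero]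
    exact Submodule.zero_mem _
  | tmul x y => exact Submodule.subset_span ⟨x, y, rfl⟩
  | add s t hs ht =>
    rw [map_add, UniformSpace.Completion.coe_add]
    exact Submodule.add_mem _ hs ht

theorem projTensor_ext {S T : ProjTensor 𝕜 E F →L[𝕜] G}
    (h : ∀ x y, S (ptmul 𝕜 x y) = T (ptmul 𝕜 x y)) : S = T := by
  refine ContinuousLinearMap.ext_on (dense_span_ptmul 𝕜 E F) ?_
  rintro _ ⟨x, y, rfl⟩
  exact h x y

theorem tendsto_of_tendsto_ptmul {ι : Type*} {l : Filter ι} {L : ι → ProjTensor 𝕜 E F →L[𝕜] G}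
    {L₀ : ProjTensor 𝕜 E F →L[𝕜] G} {C : ℝ} (hC : ∀ i, ‖L i‖ ≤ C)
    (h : ∀ x y, Tendsto (fun i => L i (ptmul 𝕜 x y)) l (𝓝 (L₀ (ptmul 𝕜 x y))))
    (t : ProjTensor 𝕜 E F) : Tendsto (fun i => L i t) l (𝓝 (L₀ t)) := by
  refine tendsto_apply_of_mem_closure_span hC ?_ (dense_span_ptmul 𝕜 E F t)
  rintro _ ⟨x, y, rfl⟩
  exact h x y

theorem norm_projLift_apply_le [CompleteSpace G] (B : E →L[𝕜] F →L[𝕜] G) (t : ProjTensor 𝕜 E F) :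
    ‖projLift B t‖ ≤ ‖B‖ * ‖t‖ := by
  induction t using UniformSpace.Completion.induction_on with
  | hp => exact isClosed_le (by fun_prop) (by fun_prop)
  | ih t =>
    rw [projLift_coe, UniformSpace.Completion.norm_coe]
    exact (algLift B).le_of_opNorm_le (LinearMap.mkContinuous_norm_le _ (norm_nonneg B) _) t

theorem norm_ptmul_le (x : E) (y : F) : ‖ptmul 𝕜 x y‖ ≤ ‖x‖ * ‖y‖ := by
  rw [ptmul, UniformSpace.Completion.norm_coe, norm_eq_projNorm]
  simpa [tensorSum, tensorCost] using projNorm_le 𝕜 [(x, y)]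

theorem norm_projMap_apply_le (S : E →L[𝕜] E') (T : F →L[𝕜] F') (t : ProjTensor 𝕜 E F) :
    ‖projMap S T t‖ ≤ ‖S‖ * ‖T‖ * ‖t‖ := by
  refine (norm_projLift_apply_le _ t).trans ?_
  gcongr
  refine ContinuousLinearMap.opNorm_le_bound₂ _ (by positivity) fun x y => ?_
  rw [ContinuousLinearMap.bilinearComp_apply, ptmulL_apply]
  calc ‖ptmul 𝕜 (S x) (T y)‖ ≤ ‖S x‖ * ‖T y‖ := norm_ptmul_le _ _
    _ ≤ (‖S‖ * ‖x‖) * (‖T‖ * ‖y‖) := by gcongr <;> exact ContinuousLinearMap.le_opNorm _ _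
    _ = ‖S‖ * ‖T‖ * ‖x‖ * ‖y‖ := by ring

end Projective

section FiniteRank

variable {𝕜 : Type*} [RCLike 𝕜] {X Y Z : Type*} [NormedAddCommGroup X] [NormedSpace 𝕜 X]
  [NormedAddCommGroup Y] [NormedSpace 𝕜 Y] [NormedAddCommGroup Z] [NormedSpace 𝕜 Z]

theorem mem_finiteRank_of_dom [FiniteDimensional 𝕜 X] (T : X →L[𝕜] Y) : T ∈ finiteRank 𝕜 X Y := by
  change FiniteDimensional 𝕜 (LinearMap.range T.toLinearMap)
  infer_instance

theorem mem_finiteRank_of_codom [FiniteDimensional 𝕜 Y] (T : X →L[𝕜] Y) :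
    T ∈ finiteRank 𝕜 X Y := by
  change FiniteDimensional 𝕜 (LinearMap.range T.toLinearMap)
  infer_instance

theorem mem_span_smulRight {T : X →L[𝕜] Y} (hT : T ∈ finiteRank 𝕜 X Y) :
    T ∈ Submodule.span 𝕜 {S : X →L[𝕜] Y | ∃ (f : StrongDual 𝕜 X) (y : Y), f.smulRight y = S} := by
  have : FiniteDimensional 𝕜 (LinearMap.range T.toLinearMap) := hT
  let b := Module.finBasis 𝕜 (LinearMap.range T.toLinearMap)
  let T' : X →L[𝕜] LinearMap.range T.toLinearMap := T.codRestrict _ fun x => ⟨x, rfl⟩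
  have hsum : T = ∑ i, ((LinearMap.toContinuousLinearMap (b.coord i)).comp T').smulRight
      (b i : Y) := by
    ext x
    have hx : T x = (LinearMap.range T.toLinearMap).subtype (T' x) := rfl
    rw [hx, ← b.sum_repr (T' x), map_sum, sum_apply]
    rfl
  rw [hsum]
  exact Submodule.sum_mem _ fun i _ => Submodule.subset_span ⟨_, _, rfl⟩

theorem norm_postcomp_le (W : Y →L[𝕜] Z) : ‖postcomp (X := X) W‖ ≤ ‖W‖ :=
  ContinuousLinearMap.opNorm_le_bound _ (norm_nonneg _) fun T => W.opNorm_comp_le T.1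

theorem norm_precomp_le (W : X →L[𝕜] Y) : ‖precomp (Z := Z) W‖ ≤ ‖W‖ :=
  ContinuousLinearMap.opNorm_le_bound _ (norm_nonneg _) fun T => by
    rw [mul_comm]
    exact T.1.opNorm_comp_le W

end FiniteRank

section Approximable

variable {𝕜 : Type*} [RCLike 𝕜] {X Y Z : Type*} [NormedAddCommGroup X] [NormedSpace 𝕜 X]
  [NormedAddCommGroup Y] [NormedSpace 𝕜 Y] [NormedAddCommGroup Z] [NormedSpace 𝕜 Z]

theorem mem_approximable {T : X →L[𝕜] X} (hT : T ∈ finiteRank 𝕜 X X) : T ∈ approximable 𝕜 X :=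
  subset_closure hT

theorem mem_closure_span_smulRight {T : X →L[𝕜] X} (hT : T ∈ approximable 𝕜 X) :
    T ∈ closure (Submodule.span 𝕜
      {S : X →L[𝕜] X | ∃ (f : StrongDual 𝕜 X) (x : X), f.smulRight x = S} : Set (X →L[𝕜] X)) :=
  closure_mono (fun _ hS => mem_span_smulRight hS) hT

section Tendsto

variable {ι : Type*} {l : Filter ι} {L : ι → X →L[𝕜] X} {C : ℝ}

theorem tendsto_comp_of_approximable (hC : ∀ i, ‖L i‖ ≤ C)
    (h : ∀ x, Tendsto (fun i => L i x) l (𝓝 x)) {T : X →L[𝕜] X} (hT : T ∈ approximable 𝕜 X) :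
    Tendsto (fun i => (L i).comp T) l (𝓝 T) := by
  refine tendsto_apply_of_mem_closure_span
    (L := fun i => ContinuousLinearMap.compL 𝕜 X X X (L i))
    (L₀ := ContinuousLinearMap.id 𝕜 (X →L[𝕜] X)) (C := C) (fun i => ?_) ?_
    (mem_closure_span_smulRight hT)
  · refine ContinuousLinearMap.opNorm_le_bound _ ((norm_nonneg _).trans (hC i)) fun S => ?_
    exact ((L i).opNorm_comp_le S).trans (by gcongr; exact hC i)
  · rintro _ ⟨f, x, rfl⟩
    refine (((ContinuousLinearMap.smulRightL 𝕜 X X f).continuous.tendsto x).comp (h x)).congr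
      fun i => ?_
    ext y
    simp

theorem tendsto_approximable_comp (hC : ∀ i, ‖L i‖ ≤ C)
    (h : ∀ f : StrongDual 𝕜 X, Tendsto (fun i => f.comp (L i)) l (𝓝 f)) {T : X →L[𝕜] X}
    (hT : T ∈ approximable 𝕜 X) : Tendsto (fun i => T.comp (L i)) l (𝓝 T) := by
  refine tendsto_apply_of_mem_closure_span
    (L := fun i => (ContinuousLinearMap.compL 𝕜 X X X).flip (L i))
    (L₀ := ContinuousLinearMap.id 𝕜 (X →L[𝕜] X)) (C := C) (fun i => ?_) ?_
    (mem_closure_span_smulRight hT)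
  · refine ContinuousLinearMap.opNorm_le_bound _ ((norm_nonneg _).trans (hC i)) fun S => ?_
    rw [mul_comm]
    exact (S.opNorm_comp_le (L i)).trans (by gcongr; exact hC i)
  · rintro _ ⟨f, x, rfl⟩
    exact (((ContinuousLinearMap.smulRightL 𝕜 X X).flip x).continuous.tendsto f).comp (h f)

theorem isBoundedApproxIdentity_of_tendsto {e : ι → approximable 𝕜 X} (hC : ∀ i, ‖e i‖ ≤ C)
    (h : ∀ x, Tendsto (fun i => (e i : X →L[𝕜] X) x) l (𝓝 x))
    (h' : ∀ f : StrongDual 𝕜 X, Tendsto (fun i => f.comp (e i : X →L[𝕜] X)) l (𝓝 f)) :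
    IsBoundedApproxIdentity l e where
  bounded := ⟨C, hC⟩
  tendsto_mul_left a := tendsto_subtype_rng.2 (tendsto_comp_of_approximable hC h a.2)
  tendsto_mul_right a := tendsto_subtype_rng.2 (tendsto_approximable_comp hC h' a.2)

end Tendsto

variable [FiniteDimensional 𝕜 Y]

/-- The map `U ↦ S U R` from the operators on a finite-dimensional space to `A(X)`. -/
def sandwich (S : Z →L[𝕜] X) (R : X →L[𝕜] Y) : (Y →L[𝕜] Z) →L[𝕜] approximable 𝕜 X :=
  LinearMap.mkContinuous
    { toFun U := ⟨(S.comp U).comp R,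
        mem_approximable (comp_mem_finiteRank_right (mem_finiteRank_of_dom _) R)⟩
      map_add' U V := Subtype.ext (by ext x; simp)
      map_smul' c U := Subtype.ext (by ext x; simp) } (‖S‖ * ‖R‖) fun U =>
    calc ‖(S.comp U).comp R‖ ≤ ‖S.comp U‖ * ‖R‖ := ContinuousLinearMap.opNorm_comp_le _ _
      _ ≤ ‖S‖ * ‖U‖ * ‖R‖ := by gcongr; exact ContinuousLinearMap.opNorm_comp_le _ _
      _ = ‖S‖ * ‖R‖ * ‖U‖ := by ring

theorem norm_sandwich_le (S : Z →L[𝕜] X) (R : X →L[𝕜] Y) : ‖sandwich S R‖ ≤ ‖S‖ * ‖R‖ :=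
  LinearMap.mkContinuous_norm_le _ (by positivity) _

theorem norm_sandwich_comp_subtypeL_le (S : Z →L[𝕜] X) (R : X →L[𝕜] Y) :
    ‖(sandwich S R).comp (finiteRank 𝕜 Y Z).subtypeL‖ ≤ ‖S‖ * ‖R‖ := by
  refine ContinuousLinearMap.opNorm_le_bound _ (by positivity) fun U => ?_
  exact (sandwich S R).le_of_opNorm_le (norm_sandwich_le S R) U

theorem sandwich_mul_sandwich {Y' : Type*} [NormedAddCommGroup Y'] [NormedSpace 𝕜 Y']
    [FiniteDimensional 𝕜 Y'] {S : Z →L[𝕜] X} {R : X →L[𝕜] Y'} {S' : Y' →L[𝕜] X} {R' : X →L[𝕜] Y}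
    (h : ∀ y, R (S' y) = y) (U : Y' →L[𝕜] Z) (V : Y →L[𝕜] Y') :
    sandwich S R U * sandwich S' R' V = sandwich S R' (U.comp V) := by
  refine Subtype.ext (ContinuousLinearMap.ext fun x => ?_)
  exact congrArg (fun y => S (U y)) (h (V (R' x)))

end Approximable

section Product

variable {𝕜 : Type*} [RCLike 𝕜] {Y Z : Type*} [NormedAddCommGroup Y] [NormedSpace 𝕜 Y]
  [NormedAddCommGroup Z] [NormedSpace 𝕜 Z] [CompleteSpace Y]

theorem prodMap_ptmul (U : finiteRank 𝕜 Z Y) (V : finiteRank 𝕜 Y Z) :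
    prodMap 𝕜 Y Z (ptmul 𝕜 U V) = U.1.comp V.1 :=
  projLift_ptmul _ U V

theorem norm_prodMap_apply_le (Δ : ProjTensor 𝕜 (finiteRank 𝕜 Z Y) (finiteRank 𝕜 Y Z)) :
    ‖prodMap 𝕜 Y Z Δ‖ ≤ ‖Δ‖ := by
  rw [← one_mul ‖Δ‖]
  refine (norm_projLift_apply_le _ Δ).trans ?_
  gcongr
  refine ContinuousLinearMap.opNorm_le_bound₂ _ zero_le_one fun U V => ?_
  rw [one_mul]
  exact U.1.opNorm_comp_le V.1

theorem prodMap_leftAct (W : Y →L[𝕜] Y)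
    (Δ : ProjTensor 𝕜 (finiteRank 𝕜 Z Y) (finiteRank 𝕜 Y Z)) :
    prodMap 𝕜 Y Z (leftAct W Δ) = W.comp (prodMap 𝕜 Y Z Δ) := by
  have h : (prodMap 𝕜 Y Z).comp (projMap (postcomp W) (ContinuousLinearMap.id 𝕜 _)) =
      (ContinuousLinearMap.compL 𝕜 Y Y Y W).comp (prodMap 𝕜 Y Z) := by
    refine projTensor_ext fun U V => ?_
    simp only [ContinuousLinearMap.comp_apply, projMap_ptmul, prodMap_ptmul]
    rfl
  exact DFunLike.congr_fun h Δ

theorem prodMap_rightAct (W : Y →L[𝕜] Y)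
    (Δ : ProjTensor 𝕜 (finiteRank 𝕜 Z Y) (finiteRank 𝕜 Y Z)) :
    prodMap 𝕜 Y Z (rightAct Δ W) = (prodMap 𝕜 Y Z Δ).comp W := by
  have h : (prodMap 𝕜 Y Z).comp (projMap (ContinuousLinearMap.id 𝕜 _) (precomp W)) =
      ((ContinuousLinearMap.compL 𝕜 Y Y Y).flip W).comp (prodMap 𝕜 Y Z) := by
    refine projTensor_ext fun U V => ?_
    simp only [ContinuousLinearMap.comp_apply, projMap_ptmul, prodMap_ptmul]
    rfl
  exact DFunLike.congr_fun h Δ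

end Product

section InnerForm

open BanachBimodule

variable {𝕜 : Type*} [RCLike 𝕜] {A : Type*} [NonUnitalNormedRing A] [NormedSpace 𝕜 A]
  {E F G : Type*} [NormedAddCommGroup E] [NormedSpace 𝕜 E] [NormedAddCommGroup F]
  [NormedSpace 𝕜 F] [NormedAddCommGroup G] [NormedSpace 𝕜 G] (M : BanachBimodule 𝕜 A E)
  {D : A →L[𝕜] StrongDual 𝕜 E}

/-- The bilinear map `(U, V) ↦ σ U · D (ρ V)`, which turns a tensor `∑ U ⊗ V` into the functional
`∑ σ U · D (ρ V)`. -/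
def innerForm (D : A →L[𝕜] StrongDual 𝕜 E) (σ : F →L[𝕜] A) (ρ : G →L[𝕜] A) :
    F →L[𝕜] G →L[𝕜] StrongDual 𝕜 E :=
  (ContinuousLinearMap.compL 𝕜 E E 𝕜).flip.bilinearComp (M.right.comp σ) (D.comp ρ)

theorem innerForm_apply (σ : F →L[𝕜] A) (ρ : G →L[𝕜] A) (U : F) (V : G) (x : E) :
    innerForm M D σ ρ U V x = D (ρ V) (M.right (σ U) x) := rfl

theorem norm_innerForm_le (σ : F →L[𝕜] A) (ρ : G →L[𝕜] A) :
    ‖innerForm M D σ ρ‖ ≤ ‖D‖ * ‖ρ‖ * (‖M.right‖ * ‖σ‖) := by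
  refine ContinuousLinearMap.opNorm_le_bound₂ _ (by positivity) fun U V => ?_
  calc ‖innerForm M D σ ρ U V‖ ≤ ‖D (ρ V)‖ * ‖M.right (σ U)‖ :=
        ContinuousLinearMap.opNorm_comp_le _ _
    _ ≤ (‖D‖ * (‖ρ‖ * ‖V‖)) * (‖M.right‖ * (‖σ‖ * ‖U‖)) := by
        gcongr
        · exact D.le_opNorm_of_le (ρ.le_opNorm V)
        · exact M.right.le_opNorm_of_le (σ.le_opNorm U)
    _ = ‖D‖ * ‖ρ‖ * (‖M.right‖ * ‖σ‖) * ‖U‖ * ‖V‖ := by ring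

variable {M}

theorem BanachBimodule.IsDerivation.innerDer_projLift_innerForm (hD : M.IsDerivation D)
    {σ : F →L[𝕜] A} {ρ : G →L[𝕜] A} {w : A} {L : F →L[𝕜] F} {R : G →L[𝕜] G}
    (hL : ∀ U, σ (L U) = w * σ U) (hR : ∀ V, ρ (R V) = ρ V * w) {m : ProjTensor 𝕜 F G →L[𝕜] A}
    (hm : ∀ U V, m (ptmul 𝕜 U V) = σ U * ρ V) {Δ : ProjTensor 𝕜 F G}
    (hcomm : projMap L (ContinuousLinearMap.id 𝕜 G) Δ =
      projMap (ContinuousLinearMap.id 𝕜 F) R Δ) (x : E) :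
    M.innerDer (projLift (innerForm M D σ ρ) Δ) w x = D w (M.right (m Δ) x) := by
  have h : (ContinuousLinearMap.apply 𝕜 𝕜 (M.right w x) -
        ContinuousLinearMap.apply 𝕜 𝕜 (M.left w x)).comp (projLift (innerForm M D σ ρ)) =
      ((ContinuousLinearMap.apply 𝕜 𝕜 x).comp (projLift (innerForm M D σ ρ))).comp
        (projMap L (ContinuousLinearMap.id 𝕜 G) - projMap (ContinuousLinearMap.id 𝕜 F) R) +
      ((D w).comp (M.right.flip x)).comp m := by
    refine projTensor_ext fun U V => ?_
    simp only [ContinuousLinearMap.comp_apply, sub_apply, add_apply, map_sub,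
      ContinuousLinearMap.apply_apply, projMap_ptmul, projLift_ptmul, hm, hL, hR,
      innerForm_apply, ContinuousLinearMap.id_apply, ContinuousLinearMap.flip_apply,
      M.right_mul, hD.apply_mul, M.left_right]
    ring
  have hΔ := DFunLike.congr_fun h Δ
  simp only [ContinuousLinearMap.comp_apply, sub_apply, add_apply, hcomm, sub_self,
    map_zero, zero_add] at hΔ
  exact (innerDer_apply _ w x).trans hΔ

end InnerForm

section Retracts

variable {𝕜 : Type*} [RCLike 𝕜] {X : Type*} [NormedAddCommGroup X] [NormedSpace 𝕜 X]
  {Y Z : Type*} [NormedAddCommGroup Y] [NormedSpace 𝕜 Y] [FiniteDimensional 𝕜 Y]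
  [NormedAddCommGroup Z] [NormedSpace 𝕜 Z] [FiniteDimensional 𝕜 Z]
  {E : Type*} [NormedAddCommGroup E] [NormedSpace 𝕜 E]
  {M : BanachBimodule 𝕜 (approximable 𝕜 X) E} {D : approximable 𝕜 X →L[𝕜] StrongDual 𝕜 E}

theorem IsGeneralizedDiagonal.prodMap_eq_id [CompleteSpace Y]
    {Δ : ProjTensor 𝕜 (finiteRank 𝕜 Z Y) (finiteRank 𝕜 Y Z)}
    (hΔ : IsGeneralizedDiagonal (finiteRankAlg 𝕜 Y) Δ) :
    prodMap 𝕜 Y Z Δ = ContinuousLinearMap.id 𝕜 Y :=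
  hΔ.2 (ContinuousLinearMap.id 𝕜 Y) (mem_finiteRank_of_dom _)

theorem sandwich_prodMap_ptmul [CompleteSpace Y] {S : Y →L[𝕜] X} {R : X →L[𝕜] Y}
    {S' : Z →L[𝕜] X} {R' : X →L[𝕜] Z} (hRS' : ∀ z, R' (S' z) = z) (U : finiteRank 𝕜 Z Y)
    (V : finiteRank 𝕜 Y Z) :
    (sandwich S R).comp (prodMap 𝕜 Y Z) (ptmul 𝕜 U V) =
      (sandwich S R').comp (finiteRank 𝕜 Z Y).subtypeL U *
        (sandwich S' R).comp (finiteRank 𝕜 Y Z).subtypeL V :=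
  (congrArg (sandwich S R) (prodMap_ptmul U V)).trans (sandwich_mul_sandwich hRS' U.1 V.1).symm

theorem IsGeneralizedDiagonal.exists_innerDer_sandwich_eq
    {Δ : ProjTensor 𝕜 (finiteRank 𝕜 Z Y) (finiteRank 𝕜 Y Z)}
    (hΔ : IsGeneralizedDiagonal (finiteRankAlg 𝕜 Y) Δ) (hD : M.IsDerivation D)
    {S : Y →L[𝕜] X} {R : X →L[𝕜] Y} (hRS : ∀ y, R (S y) = y)
    {S' : Z →L[𝕜] X} {R' : X →L[𝕜] Z} (hRS' : ∀ z, R' (S' z) = z) :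
    ∃ φ : StrongDual 𝕜 E,
      ‖φ‖ ≤ ‖D‖ * (‖S'‖ * ‖R‖) * (‖M.right‖ * (‖S‖ * ‖R'‖)) * ‖Δ‖ ∧
      ∀ W x, M.innerDer φ (sandwich S R W) x =
        D (sandwich S R W) (M.right (sandwich S R (ContinuousLinearMap.id 𝕜 Y)) x) := by
  have : CompleteSpace Y := FiniteDimensional.complete 𝕜 Y
  let σ := (sandwich S R').comp (finiteRank 𝕜 Z Y).subtypeL
  let ρ := (sandwich S' R).comp (finiteRank 𝕜 Y Z).subtypeL
  refine ⟨projLift (innerForm M D σ ρ) Δ, ?_, fun W x => ?_⟩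
  · refine (norm_projLift_apply_le _ Δ).trans ?_
    gcongr
    refine (norm_innerForm_le M σ ρ).trans ?_
    gcongr <;> exact norm_sandwich_comp_subtypeL_le _ _
  · have hL : ∀ U, σ (postcomp W U) = sandwich S R W * σ U := fun U =>
      (sandwich_mul_sandwich hRS W U.1).symm
    have hR : ∀ V, ρ (precomp W V) = ρ V * sandwich S R W := fun V =>
      (sandwich_mul_sandwich hRS V.1 W).symm
    have hid : (sandwich S R).comp (prodMap 𝕜 Y Z) Δ =
        sandwich S R (ContinuousLinearMap.id 𝕜 Y) := congrArg (sandwich S R) hΔ.prodMap_eq_id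
    have h := hD.innerDer_projLift_innerForm hL hR (sandwich_prodMap_ptmul hRS')
      (hΔ.1 W (mem_finiteRank_of_dom W)) x
    rwa [hid] at h

end Retracts

section Projections

variable {𝕜 : Type*} [RCLike 𝕜] {X : Type*} [NormedAddCommGroup X] [NormedSpace 𝕜 X]

namespace ApproxProj

/-- The inclusion of the range of a projection. -/
def incl (p : ApproxProj 𝕜 X) : p.rg →L[𝕜] X := p.rg.subtypeL

/-- A projection, regarded as an operator onto its range. -/
def proj (p : ApproxProj 𝕜 X) : X →L[𝕜] p.rg := p.op.codRestrict p.rg fun x => ⟨x, rfl⟩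

theorem proj_incl (p : ApproxProj 𝕜 X) (x : p.rg) : p.proj (p.incl x) = x :=
  Subtype.ext (p.op_apply_of_mem x.2)

theorem norm_incl_le (p : ApproxProj 𝕜 X) : ‖p.incl‖ ≤ 1 := p.rg.norm_subtypeL_le

theorem norm_proj_le (p : ApproxProj 𝕜 X) : ‖p.proj‖ ≤ ‖p.op‖ :=
  ContinuousLinearMap.opNorm_le_bound _ (norm_nonneg _) fun x => p.op.le_opNorm x

theorem norm_incl_mul_norm_proj_le (p : ApproxProj 𝕜 X) : ‖p.incl‖ * ‖p.proj‖ ≤ ‖p.op‖ :=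
  (mul_le_of_le_one_left (norm_nonneg _) p.norm_incl_le).trans p.norm_proj_le

end ApproxProj

variable [CompleteSpace X]

theorem isAmenable_of_generalizedDiagonals {ι : Type*} {l : Filter ι} [l.NeBot]
    {P : ι → ApproxProj 𝕜 X} (hP : IsBoundedApproxIdentity l fun α => (P α).1) {K : ℝ}
    (hdiag : ∀ α, ∃ β, ∃ Δ : ProjTensor 𝕜 (finiteRank 𝕜 (P β).rg (P α).rg)
        (finiteRank 𝕜 (P α).rg (P β).rg),
      IsGeneralizedDiagonal (finiteRankAlg 𝕜 (P α).rg) Δ ∧ ‖Δ‖ ≤ K) :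
    IsAmenable 𝕜 (approximable 𝕜 X) := by
  intro E _ _ _ M D hD
  replace hD : M.IsDerivation D := hD
  obtain ⟨C, hC⟩ := hP.bounded
  have hproj : ∀ α, ‖(P α).proj‖ ≤ C := fun α => (P α).norm_proj_le.trans (hC α)
  have hlocal : ∀ α, ∃ φ : StrongDual 𝕜 E,
      ‖φ‖ ≤ ‖D‖ * (1 * C) * (‖M.right‖ * (1 * C)) * K ∧
      ∀ W x, M.innerDer φ (sandwich (P α).incl (P α).proj W) x =
        D (sandwich (P α).incl (P α).proj W) (M.right (P α).1 x) := by
    intro α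
    obtain ⟨β, Δ, hΔ, hK⟩ := hdiag α
    obtain ⟨φ, hφ, hcomm⟩ := hΔ.exists_innerDer_sandwich_eq hD (P α).proj_incl (P β).proj_incl
    refine ⟨φ, hφ.trans ?_, hcomm⟩
    have hC₀ : 0 ≤ C := (norm_nonneg _).trans (hproj α)
    gcongr
    exacts [(P β).norm_incl_le, hproj α, (P α).norm_incl_le, hproj β]
  choose f hf hcomm using hlocal
  obtain ⟨φ, rfl⟩ := hD.exists_eq_innerDer_of_corners hP hf fun α a x =>
    hcomm α (((P α).proj.comp a.1).comp (P α).incl) x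
  exact ⟨φ, BanachBimodule.innerDer_eq_dualLeft_sub_dualRight φ⟩

end Projections

section DualBases

variable {𝕜 : Type*} [RCLike 𝕜] {Y V : Type*} [NormedAddCommGroup Y] [NormedSpace 𝕜 Y]
  [FiniteDimensional 𝕜 Y] {κ : Type*} [Fintype κ]

/-- The coordinate functionals of a basis of a finite-dimensional normed space, as bounded
functionals. -/
def coordL (b : Module.Basis κ 𝕜 Y) (i : κ) : StrongDual 𝕜 Y :=
  LinearMap.toContinuousLinearMap (b.coord i)

theorem sum_coordL_smul (b : Module.Basis κ 𝕜 Y) (y : Y) : ∑ i, coordL b i y • b i = y :=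
  b.sum_repr y

theorem sum_smul_coordL (b : Module.Basis κ 𝕜 Y) (g : StrongDual 𝕜 Y) :
    ∑ i, g (b i) • coordL b i = g := by
  ext y
  conv_rhs => rw [← sum_coordL_smul b y, map_sum]
  simp [mul_comm]

theorem sum_apply_coordL_comm [NormedAddCommGroup V] [NormedSpace 𝕜 V]
    (b : Module.Basis κ 𝕜 Y) (β : Y →L[𝕜] StrongDual 𝕜 Y →L[𝕜] V) (W : Y →L[𝕜] Y) :
    ∑ i, β (W (b i)) (coordL b i) = ∑ i, β (b i) ((coordL b i).comp W) := by
  calc ∑ i, β (W (b i)) (coordL b i)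
      = ∑ i, ∑ j, coordL b j (W (b i)) • β (b j) (coordL b i) := by
        refine Finset.sum_congr rfl fun i _ => ?_
        conv_lhs => rw [← sum_coordL_smul b (W (b i))]
        simp
    _ = ∑ j, ∑ i, coordL b j (W (b i)) • β (b j) (coordL b i) := Finset.sum_comm
    _ = ∑ j, β (b j) ((coordL b j).comp W) := by
        refine Finset.sum_congr rfl fun j _ => ?_
        conv_rhs => rw [← sum_smul_coordL b ((coordL b j).comp W)]
        simp

end DualBases

section CentralTensors

variable {𝕜 : Type*} [RCLike 𝕜] {Y Z : Type*} [NormedAddCommGroup Y] [NormedSpace 𝕜 Y]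
  [NormedAddCommGroup Z] [NormedSpace 𝕜 Z]

variable (𝕜 Y Z) in
/-- The tensors `Δ` such that `W Δ = Δ W` for all operators `W` on `Y`. -/
def centralTensors : Submodule 𝕜 (ProjTensor 𝕜 (finiteRank 𝕜 Z Y) (finiteRank 𝕜 Y Z)) where
  carrier := {Δ | ∀ W, leftAct W Δ = rightAct Δ W}
  zero_mem' _ := (map_zero _).trans (map_zero _).symm
  add_mem' h h' W :=
    (map_add _ _ _).trans <| (congrArg₂ (· + ·) (h W) (h' W)).trans (map_add _ _ _).symm
  smul_mem' c _ h W :=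
    (map_smul _ c _).trans <| (congrArg (c • ·) (h W)).trans (map_smul _ c _).symm

section EvalProd

variable [CompleteSpace Y]

/-- The functional `Δ ↦ f (π(Δ) u)`. -/
def evalProd (u : Y) (f : StrongDual 𝕜 Y) :
    StrongDual 𝕜 (ProjTensor 𝕜 (finiteRank 𝕜 Z Y) (finiteRank 𝕜 Y Z)) :=
  (f.comp (ContinuousLinearMap.apply 𝕜 Y u)).comp (prodMap 𝕜 Y Z)

theorem evalProd_ptmul (u : Y) (f : StrongDual 𝕜 Y) (U : finiteRank 𝕜 Z Y)
    (V : finiteRank 𝕜 Y Z) : evalProd u f (ptmul 𝕜 U V) = f (U.1 (V.1 u)) :=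
  congrArg (fun T : Y →L[𝕜] Y => f (T u)) (prodMap_ptmul U V)

theorem prodMap_comp_comm_of_mem_centralTensors
    {Δ : ProjTensor 𝕜 (finiteRank 𝕜 Z Y) (finiteRank 𝕜 Y Z)} (hΔ : Δ ∈ centralTensors 𝕜 Y Z)
    (W : Y →L[𝕜] Y) : W.comp (prodMap 𝕜 Y Z Δ) = (prodMap 𝕜 Y Z Δ).comp W := by
  rw [← prodMap_leftAct, hΔ W, prodMap_rightAct]

theorem prodMap_eq_smul_id_of_mem_centralTensors {u : Y} {f : StrongDual 𝕜 Y} (hu : f u = 1)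
    {Δ : ProjTensor 𝕜 (finiteRank 𝕜 Z Y) (finiteRank 𝕜 Y Z)} (hΔ : Δ ∈ centralTensors 𝕜 Y Z) :
    prodMap 𝕜 Y Z Δ = evalProd u f Δ • ContinuousLinearMap.id 𝕜 Y := by
  ext y
  have h := DFunLike.congr_fun (prodMap_comp_comm_of_mem_centralTensors hΔ (f.smulRight y)) u
  simpa [hu, evalProd] using h.symm

end EvalProd

variable [FiniteDimensional 𝕜 Y]

/-- The bilinear map `(y, g) ↦ (z ↦ h z • y) ⊗ (y' ↦ g y' • z₀)`. -/
def rankOneForm (h : StrongDual 𝕜 Z) (z₀ : Z) :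
    Y →L[𝕜] StrongDual 𝕜 Y →L[𝕜] ProjTensor 𝕜 (finiteRank 𝕜 Z Y) (finiteRank 𝕜 Y Z) :=
  (ptmulL 𝕜 (finiteRank 𝕜 Z Y) (finiteRank 𝕜 Y Z)).bilinearComp
    ((ContinuousLinearMap.smulRightL 𝕜 Z Y h).codRestrict (finiteRank 𝕜 Z Y)
      fun _ => mem_finiteRank_of_codom _)
    (((ContinuousLinearMap.smulRightL 𝕜 Y Z).flip z₀).codRestrict (finiteRank 𝕜 Y Z)
      fun _ => mem_finiteRank_of_dom _)

theorem ptmul_eq_rankOneForm {h : StrongDual 𝕜 Z} {z₀ : Z} {y : Y} {g : StrongDual 𝕜 Y}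
    {U : finiteRank 𝕜 Z Y} {V : finiteRank 𝕜 Y Z} (hU : U.1 = h.smulRight y)
    (hV : V.1 = g.smulRight z₀) : ptmul 𝕜 U V = rankOneForm h z₀ y g :=
  (congrArg₂ (ptmul 𝕜) (Subtype.ext hU) (Subtype.ext hV)).trans (ptmulL_apply _ _).symm

/-- The operator `Δ ↦ ∑ i, (bᵢ ⊗ f) Δ (u ⊗ bᵢ*)`, where `bᵢ` is a basis with dual basis `bᵢ*`. It
maps every tensor to a central one. -/
def average (u : Y) (f : StrongDual 𝕜 Y) :
    ProjTensor 𝕜 (finiteRank 𝕜 Z Y) (finiteRank 𝕜 Y Z) →L[𝕜]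
      ProjTensor 𝕜 (finiteRank 𝕜 Z Y) (finiteRank 𝕜 Y Z) :=
  ∑ i, projMap (postcomp (f.smulRight (Module.finBasis 𝕜 Y i)))
    (precomp ((coordL (Module.finBasis 𝕜 Y) i).smulRight u))

theorem average_ptmul (u : Y) (f : StrongDual 𝕜 Y) (U : finiteRank 𝕜 Z Y)
    (V : finiteRank 𝕜 Y Z) :
    average u f (ptmul 𝕜 U V) = ∑ i, ptmul 𝕜 (postcomp (f.smulRight (Module.finBasis 𝕜 Y i)) U)
      (precomp ((coordL (Module.finBasis 𝕜 Y) i).smulRight u) V) := by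
  rw [average, sum_apply]
  exact Finset.sum_congr rfl fun i _ => projMap_ptmul _ _ _ _

theorem average_mem_centralTensors (u : Y) (f : StrongDual 𝕜 Y)
    (Δ : ProjTensor 𝕜 (finiteRank 𝕜 Z Y) (finiteRank 𝕜 Y Z)) :
    average u f Δ ∈ centralTensors 𝕜 Y Z := by
  intro W
  have h : (projMap (postcomp (X := Z) W) (ContinuousLinearMap.id 𝕜 _)).comp (average u f) =
      (projMap (ContinuousLinearMap.id 𝕜 _) (precomp (Z := Z) W)).comp (average u f) := by
    refine projTensor_ext fun U V => ?_
    let b := Module.finBasis 𝕜 Y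
    let β := rankOneForm (Y := Y) (f.comp U.1) (V.1 u)
    have hVu : ∀ g : StrongDual 𝕜 Y, (precomp (g.smulRight u) V).1 = g.smulRight (V.1 u) := fun g =>
      ContinuousLinearMap.ext fun y => map_smul V.1 (g y) u
    simp only [ContinuousLinearMap.comp_apply, average_ptmul, map_sum, projMap_ptmul]
    calc _ = ∑ i, β (W (b i)) (coordL b i) := Finset.sum_congr rfl fun i _ =>
          ptmul_eq_rankOneForm
            (ContinuousLinearMap.ext fun z => map_smul W (f (U.1 z)) (b i)) (hVu (coordL b i))
      _ = ∑ i, β (b i) ((coordL b i).comp W) := sum_apply_coordL_comm b β W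
      _ = _ := Finset.sum_congr rfl fun i _ =>
          (ptmul_eq_rankOneForm rfl (hVu ((coordL b i).comp W))).symm
  exact DFunLike.congr_fun h Δ

end CentralTensors

section TensorForm

variable {𝕜 : Type*} [RCLike 𝕜] {A F G : Type*} [NormedAddCommGroup A] [NormedSpace 𝕜 A]
  [NormedAddCommGroup F] [NormedSpace 𝕜 F] [NormedAddCommGroup G] [NormedSpace 𝕜 G]

/-- The adjoint of `a ⊗ b ↦ σ a ⊗ ρ b`, from the functionals on a projective tensor product to
bilinear forms. -/
def tensorForm (σ : A →L[𝕜] F) (ρ : A →L[𝕜] G) :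
    StrongDual 𝕜 (ProjTensor 𝕜 F G) →L[𝕜] A →L[𝕜] A →L[𝕜] 𝕜 :=
  LinearMap.mkContinuous
    { toFun φ := ((ContinuousLinearMap.compL 𝕜 G (ProjTensor 𝕜 F G) 𝕜 φ).comp
        (ptmulL 𝕜 F G)).bilinearComp σ ρ
      map_add' _ _ := rfl
      map_smul' _ _ := rfl } (‖σ‖ * ‖ρ‖) fun φ => by
    refine ContinuousLinearMap.opNorm_le_bound₂ _ (by positivity) fun a b => ?_
    calc ‖φ (ptmulL 𝕜 F G (σ a) (ρ b))‖ ≤ ‖φ‖ * ((‖σ‖ * ‖a‖) * (‖ρ‖ * ‖b‖)) := by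
          refine φ.le_opNorm_of_le ?_
          rw [ptmulL_apply]
          refine (norm_ptmul_le _ _).trans ?_
          gcongr <;> exact ContinuousLinearMap.le_opNorm _ _
      _ = ‖σ‖ * ‖ρ‖ * ‖φ‖ * ‖a‖ * ‖b‖ := by ring

theorem norm_tensorForm_le (σ : A →L[𝕜] F) (ρ : A →L[𝕜] G) :
    ‖tensorForm σ ρ‖ ≤ ‖σ‖ * ‖ρ‖ :=
  LinearMap.mkContinuous_norm_le _ (by positivity) _

theorem tensorForm_apply (σ : A →L[𝕜] F) (ρ : A →L[𝕜] G) (φ : StrongDual 𝕜 (ProjTensor 𝕜 F G))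
    (a b : A) : tensorForm σ ρ φ a b = φ (ptmul 𝕜 (σ a) (ρ b)) :=
  congrArg φ (ptmulL_apply _ _)

end TensorForm

section VirtualDiagonalAction

variable {𝕜 : Type*} [RCLike 𝕜] {A : Type*} [NonUnitalNormedRing A] [NormedSpace 𝕜 A]
  [IsScalarTower 𝕜 A A] [SMulCommClass 𝕜 A A] {M : StrongDual 𝕜 (A →L[𝕜] A →L[𝕜] 𝕜)}

theorem IsVirtualDiagonal.apply_sum_right_left (hM : IsVirtualDiagonal M) {κ : Type*} [Fintype κ]
    (r s : κ → A) (B : A →L[𝕜] A →L[𝕜] 𝕜) :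
    M (∑ i, (bilinForms 𝕜 A).right (r i) ((bilinForms 𝕜 A).left (s i) B)) =
      M ((bilinForms 𝕜 A).left (∑ i, r i * s i) B) := by
  simp only [map_sum, sum_apply, hM.central, BanachBimodule.left_mul]

theorem IsVirtualDiagonal.exists_mem_norm_le (hM : IsVirtualDiagonal M) {V : Type*}
    [NormedAddCommGroup V] [NormedSpace 𝕜 V] (T : StrongDual 𝕜 V →L[𝕜] A →L[𝕜] A →L[𝕜] 𝕜)
    {N : Submodule 𝕜 V} {E : V →L[𝕜] V} (hE : ∀ v, E v ∈ N) {κ : Type*} [Fintype κ] {r s : κ → A}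
    (hT : ∀ φ, T (φ.comp E) =
      ∑ i, (bilinForms 𝕜 A).right (r i) ((bilinForms 𝕜 A).left (s i) (T φ)))
    {p : A} (hrs : ∑ i, r i * s i = p) (hp : ∀ φ, (bilinForms 𝕜 A).left p (T φ) = T φ)
    {τ : StrongDual 𝕜 V} {ψ : StrongDual 𝕜 A} (hτ : T τ = (bilinForms 𝕜 A).right p (mulForm ψ))
    (hψ : ψ p = 1) :
    ∃ v ∈ N, τ v = 1 ∧ ‖v‖ ≤ ‖M‖ * ‖T‖ + 1 := by
  refine exists_mem_norm_le_of_bidual N (M.comp T) (fun φ hφ => ?_)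
    (((congrArg M hτ).trans (hM.map_right_mulForm p ψ)).trans hψ)
    ((ContinuousLinearMap.opNorm_comp_le M T).trans_lt (lt_add_one _))
  have hφE : φ.comp E = 0 := ContinuousLinearMap.ext fun v => hφ _ (hE v)
  calc M (T φ) = M (T (φ.comp E)) := by rw [hT, hM.apply_sum_right_left, hrs, hp]
    _ = 0 := by rw [hφE, map_zero, map_zero]

end VirtualDiagonalAction

section Compression

variable {𝕜 : Type*} [RCLike 𝕜] {X Y : Type*} [NormedAddCommGroup X] [NormedSpace 𝕜 X]
  [NormedAddCommGroup Y] [NormedSpace 𝕜 Y] [FiniteDimensional 𝕜 Y]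

/-- The map `a ↦ R a` from `A(X)` to the operators with values in a finite-dimensional space. -/
def compressLeft (R : X →L[𝕜] Y) : approximable 𝕜 X →L[𝕜] finiteRank 𝕜 X Y :=
  LinearMap.mkContinuous
    { toFun a := ⟨R.comp a.1, mem_finiteRank_of_codom _⟩
      map_add' a b := Subtype.ext (R.comp_add a.1 b.1)
      map_smul' c a := Subtype.ext (R.comp_smul c a.1) } ‖R‖ fun a =>
    R.opNorm_comp_le a.1

/-- The map `a ↦ a S` from `A(X)` to the operators defined on a finite-dimensional space. -/
def compressRight (S : Y →L[𝕜] X) : approximable 𝕜 X →L[𝕜] finiteRank 𝕜 Y X :=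
  LinearMap.mkContinuous
    { toFun a := ⟨a.1.comp S, mem_finiteRank_of_dom _⟩
      map_add' a b := Subtype.ext (a.1.add_comp b.1 S)
      map_smul' c a := Subtype.ext (a.1.smul_comp c S) } ‖S‖ fun a =>
    (a.1.opNorm_comp_le S).trans (mul_comm _ _).le

theorem norm_compressLeft_le (R : X →L[𝕜] Y) : ‖compressLeft R‖ ≤ ‖R‖ :=
  LinearMap.mkContinuous_norm_le _ (norm_nonneg _) _

theorem norm_compressRight_le (S : Y →L[𝕜] X) : ‖compressRight S‖ ≤ ‖S‖ :=
  LinearMap.mkContinuous_norm_le _ (norm_nonneg _) _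

variable {S : Y →L[𝕜] X} {R : X →L[𝕜] Y}

theorem compressLeft_sandwich_mul (hRS : ∀ y, R (S y) = y) (W : Y →L[𝕜] Y)
    (a : approximable 𝕜 X) :
    compressLeft R (sandwich S R W * a) = postcomp W (compressLeft R a) :=
  Subtype.ext (ContinuousLinearMap.ext fun x => hRS (W (R (a.1 x))))

theorem compressRight_mul_sandwich (hRS : ∀ y, R (S y) = y) (W : Y →L[𝕜] Y)
    (a : approximable 𝕜 X) :
    compressRight S (a * sandwich S R W) = precomp W (compressRight S a) :=
  Subtype.ext (ContinuousLinearMap.ext fun y => congrArg (fun y => a.1 (S (W y))) (hRS y))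

theorem sum_sandwich_mul_sandwich (hRS : ∀ y, R (S y) = y) {κ : Type*} [Fintype κ]
    (b : Module.Basis κ 𝕜 Y) {u : Y} {f : StrongDual 𝕜 Y} (hu : f u = 1) :
    ∑ i, sandwich S R (f.smulRight (b i)) * sandwich S R ((coordL b i).smulRight u) =
      sandwich S R (ContinuousLinearMap.id 𝕜 Y) := by
  simp only [sandwich_mul_sandwich hRS, ← map_sum]
  congr 1
  ext y
  simpa [hu] using sum_coordL_smul b y

end Compression

section CentralTensorsOfVirtualDiagonals

variable {𝕜 : Type*} [RCLike 𝕜] {X Y : Type*} [NormedAddCommGroup X] [NormedSpace 𝕜 X]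
  [NormedAddCommGroup Y] [NormedSpace 𝕜 Y] [FiniteDimensional 𝕜 Y]
  {S : Y →L[𝕜] X} {R : X →L[𝕜] Y} {u : Y} {f : StrongDual 𝕜 Y}
  {M : StrongDual 𝕜 (approximable 𝕜 X →L[𝕜] approximable 𝕜 X →L[𝕜] 𝕜)}

theorem tensorForm_comp_average (hRS : ∀ y, R (S y) = y)
    (φ : StrongDual 𝕜 (ProjTensor 𝕜 (finiteRank 𝕜 X Y) (finiteRank 𝕜 Y X))) :
    tensorForm (compressLeft R) (compressRight S) (φ.comp (average u f)) =
      ∑ i, (bilinForms 𝕜 (approximable 𝕜 X)).right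
        (sandwich S R (f.smulRight (Module.finBasis 𝕜 Y i)))
        ((bilinForms 𝕜 (approximable 𝕜 X)).left
          (sandwich S R ((coordL (Module.finBasis 𝕜 Y) i).smulRight u))
          (tensorForm (compressLeft R) (compressRight S) φ)) := by
  ext a b
  simp only [sum_apply, bilinForms_left_apply, bilinForms_right_apply, tensorForm_apply,
    compressLeft_sandwich_mul hRS, compressRight_mul_sandwich hRS,
    ContinuousLinearMap.comp_apply, average_ptmul, map_sum]

theorem left_sandwich_id_tensorForm (hRS : ∀ y, R (S y) = y)
    (φ : StrongDual 𝕜 (ProjTensor 𝕜 (finiteRank 𝕜 X Y) (finiteRank 𝕜 Y X))) :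
    (bilinForms 𝕜 (approximable 𝕜 X)).left (sandwich S R (ContinuousLinearMap.id 𝕜 Y))
        (tensorForm (compressLeft R) (compressRight S) φ) =
      tensorForm (compressLeft R) (compressRight S) φ := by
  ext a b
  rw [bilinForms_left_apply, tensorForm_apply, tensorForm_apply, compressRight_mul_sandwich hRS]
  rfl

/-- The functional `a ↦ f (R (a (S u)))`. -/
def compressedEval (S : Y →L[𝕜] X) (R : X →L[𝕜] Y) (u : Y) (f : StrongDual 𝕜 Y) :
    StrongDual 𝕜 (approximable 𝕜 X) :=
  ((f.comp R).comp (ContinuousLinearMap.apply 𝕜 X (S u))).comp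
    (finiteRankAlg 𝕜 X).topologicalClosure.toSubmodule.subtypeL

theorem tensorForm_evalProd [CompleteSpace Y] (hRS : ∀ y, R (S y) = y) :
    tensorForm (compressLeft R) (compressRight S) (evalProd u f) =
      (bilinForms 𝕜 (approximable 𝕜 X)).right (sandwich S R (ContinuousLinearMap.id 𝕜 Y))
        (mulForm (compressedEval S R u f)) := by
  ext a b
  refine (tensorForm_apply _ _ _ _ _).trans ((evalProd_ptmul u f _ _).trans ?_)
  exact congrArg f (hRS (R (a.1 (b.1 (S u))))).symm

theorem compressedEval_sandwich_id (hRS : ∀ y, R (S y) = y) (hu : f u = 1) :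
    compressedEval S R u f (sandwich S R (ContinuousLinearMap.id 𝕜 Y)) = 1 :=
  (congrArg f ((hRS _).trans (hRS u))).trans hu

set_option maxSynthPendingDepth 6 in
theorem IsVirtualDiagonal.exists_mem_centralTensors [CompleteSpace Y] (hM : IsVirtualDiagonal M)
    (hRS : ∀ y, R (S y) = y) (hu : f u = 1) :
    ∃ Δ ∈ centralTensors 𝕜 Y X, evalProd u f Δ = 1 ∧ ‖Δ‖ ≤ ‖M‖ * (‖R‖ * ‖S‖) + 1 := by
  obtain ⟨Δ, hΔ, hτ, hnorm⟩ := hM.exists_mem_norm_le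
    (V := ProjTensor 𝕜 (finiteRank 𝕜 X Y) (finiteRank 𝕜 Y X)) (N := centralTensors 𝕜 Y X)
    (E := average u f) (T := tensorForm (compressLeft R) (compressRight S))
    (r := fun i => sandwich S R (f.smulRight (Module.finBasis 𝕜 Y i)))
    (s := fun i => sandwich S R ((coordL (Module.finBasis 𝕜 Y) i).smulRight u))
    (average_mem_centralTensors u f) (tensorForm_comp_average hRS)
    (sum_sandwich_mul_sandwich hRS (Module.finBasis 𝕜 Y) hu) (left_sandwich_id_tensorForm hRS)
    (tensorForm_evalProd hRS) (compressedEval_sandwich_id hRS hu)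
  refine ⟨Δ, hΔ, hτ, hnorm.trans ?_⟩
  gcongr
  refine (norm_tensorForm_le _ _).trans ?_
  gcongr
  exacts [norm_compressLeft_le R, norm_compressRight_le S]

end CentralTensorsOfVirtualDiagonals

section Rescaling

variable {𝕜 : Type*} [RCLike 𝕜]

theorem exists_mem_apply_eq_one_norm_le {V : Type*} [NormedAddCommGroup V] [NormedSpace 𝕜 V]
    {N : Submodule 𝕜 V} {τ : StrongDual 𝕜 V} {v : V} (hv : v ∈ N) {δ : ℝ} (hδ : 0 < δ)
    (hτ : δ ≤ ‖τ v‖) : ∃ w ∈ N, τ w = 1 ∧ ‖w‖ ≤ δ⁻¹ * ‖v‖ := by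
  refine ⟨(τ v)⁻¹ • v, N.smul_mem _ hv, ?_, ?_⟩
  · rw [map_smul, smul_eq_mul, inv_mul_cancel₀ (norm_pos_iff.1 (hδ.trans_le hτ))]
  · rw [norm_smul, norm_inv]
    gcongr

end Rescaling

section Truncation

variable {𝕜 : Type*} [RCLike 𝕜] {X Y Z : Type*} [NormedAddCommGroup X] [NormedSpace 𝕜 X]
  [NormedAddCommGroup Y] [NormedSpace 𝕜 Y] [NormedAddCommGroup Z] [NormedSpace 𝕜 Z]

variable (Y) in
/-- The map `U ⊗ V ↦ U S ⊗ R V`. It replaces the middle space `X` of a tensor by `Z`. -/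
def truncate (S : Z →L[𝕜] X) (R : X →L[𝕜] Z) :
    ProjTensor 𝕜 (finiteRank 𝕜 X Y) (finiteRank 𝕜 Y X) →L[𝕜]
      ProjTensor 𝕜 (finiteRank 𝕜 Z Y) (finiteRank 𝕜 Y Z) :=
  projMap (precomp (Z := Y) S) (postcomp (X := Y) R)

theorem truncate_ptmul (S : Z →L[𝕜] X) (R : X →L[𝕜] Z) (U : finiteRank 𝕜 X Y)
    (V : finiteRank 𝕜 Y X) :
    truncate Y S R (ptmul 𝕜 U V) = ptmul 𝕜 (precomp S U) (postcomp R V) :=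
  projMap_ptmul _ _ _ _

theorem norm_truncate_apply_le (S : Z →L[𝕜] X) (R : X →L[𝕜] Z)
    (Δ : ProjTensor 𝕜 (finiteRank 𝕜 X Y) (finiteRank 𝕜 Y X)) :
    ‖truncate Y S R Δ‖ ≤ ‖S‖ * ‖R‖ * ‖Δ‖ := by
  refine (norm_projMap_apply_le _ _ Δ).trans ?_
  gcongr
  exacts [norm_precomp_le S, norm_postcomp_le R]

theorem leftAct_truncate (S : Z →L[𝕜] X) (R : X →L[𝕜] Z) (W : Y →L[𝕜] Y)
    (Δ : ProjTensor 𝕜 (finiteRank 𝕜 X Y) (finiteRank 𝕜 Y X)) :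
    leftAct W (truncate Y S R Δ) = truncate Y S R (leftAct W Δ) := by
  have h : (projMap (postcomp (X := Z) W) (ContinuousLinearMap.id 𝕜 (finiteRank 𝕜 Y Z))).comp
        (truncate Y S R) =
      (truncate Y S R).comp
        (projMap (postcomp (X := X) W) (ContinuousLinearMap.id 𝕜 (finiteRank 𝕜 Y X))) := by
    refine projTensor_ext fun U V => ?_
    simp only [ContinuousLinearMap.comp_apply, truncate_ptmul, projMap_ptmul]
    rfl
  exact DFunLike.congr_fun h Δ

theorem rightAct_truncate (S : Z →L[𝕜] X) (R : X →L[𝕜] Z) (W : Y →L[𝕜] Y)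
    (Δ : ProjTensor 𝕜 (finiteRank 𝕜 X Y) (finiteRank 𝕜 Y X)) :
    rightAct (truncate Y S R Δ) W = truncate Y S R (rightAct Δ W) := by
  have h : (projMap (ContinuousLinearMap.id 𝕜 (finiteRank 𝕜 Z Y)) (precomp (Z := Z) W)).comp
        (truncate Y S R) =
      (truncate Y S R).comp
        (projMap (ContinuousLinearMap.id 𝕜 (finiteRank 𝕜 X Y)) (precomp (Z := X) W)) := by
    refine projTensor_ext fun U V => ?_
    simp only [ContinuousLinearMap.comp_apply, truncate_ptmul, projMap_ptmul]
    rfl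
  exact DFunLike.congr_fun h Δ

theorem truncate_mem_centralTensors (S : Z →L[𝕜] X) (R : X →L[𝕜] Z)
    {Δ : ProjTensor 𝕜 (finiteRank 𝕜 X Y) (finiteRank 𝕜 Y X)} (hΔ : Δ ∈ centralTensors 𝕜 Y X) :
    truncate Y S R Δ ∈ centralTensors 𝕜 Y Z := fun W => by
  rw [leftAct_truncate, rightAct_truncate, hΔ W]

variable [CompleteSpace Y]

theorem norm_evalProd_apply_le (u : Y) (f : StrongDual 𝕜 Y)
    (Δ : ProjTensor 𝕜 (finiteRank 𝕜 Z Y) (finiteRank 𝕜 Y Z)) :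
    ‖evalProd u f Δ‖ ≤ ‖f‖ * ‖u‖ * ‖Δ‖ :=
  calc ‖f (prodMap 𝕜 Y Z Δ u)‖ ≤ ‖f‖ * (‖prodMap 𝕜 Y Z Δ‖ * ‖u‖) :=
        f.le_opNorm_of_le (ContinuousLinearMap.le_opNorm _ _)
    _ ≤ ‖f‖ * (‖Δ‖ * ‖u‖) := by gcongr; exact norm_prodMap_apply_le Δ
    _ = ‖f‖ * ‖u‖ * ‖Δ‖ := by ring

theorem norm_evalProd_comp_truncate_le (S : Z →L[𝕜] X) (R : X →L[𝕜] Z) (u : Y)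
    (f : StrongDual 𝕜 Y) : ‖(evalProd u f).comp (truncate Y S R)‖ ≤
      ‖f‖ * ‖u‖ * (‖S‖ * ‖R‖) := by
  refine ContinuousLinearMap.opNorm_le_bound _ (by positivity) fun Δ => ?_
  refine (norm_evalProd_apply_le u f (truncate Y S R Δ)).trans ?_
  rw [mul_assoc (‖f‖ * ‖u‖)]
  exact mul_le_mul_of_nonneg_left (norm_truncate_apply_le S R Δ)
    (mul_nonneg (norm_nonneg f) (norm_nonneg u))

theorem tendsto_evalProd_truncate {ι : Type*} {l : Filter ι} {Z : ι → Type*}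
    [∀ i, NormedAddCommGroup (Z i)] [∀ i, NormedSpace 𝕜 (Z i)] {S : ∀ i, Z i →L[𝕜] X}
    {R : ∀ i, X →L[𝕜] Z i} {C : ℝ} (hC : ∀ i, ‖S i‖ * ‖R i‖ ≤ C)
    (h : ∀ x, Tendsto (fun i => S i (R i x)) l (𝓝 x)) (u : Y) (f : StrongDual 𝕜 Y)
    (Δ : ProjTensor 𝕜 (finiteRank 𝕜 X Y) (finiteRank 𝕜 Y X)) :
    Tendsto (fun i => evalProd u f (truncate Y (S i) (R i) Δ)) l (𝓝 (evalProd u f Δ)) := by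
  refine tendsto_of_tendsto_ptmul (L := fun i => (evalProd u f).comp (truncate Y (S i) (R i)))
    (fun i => (norm_evalProd_comp_truncate_le (S i) (R i) u f).trans
      (mul_le_mul_of_nonneg_left (hC i) (mul_nonneg (norm_nonneg f) (norm_nonneg u))))
    (fun U V => ?_) Δ
  simp only [ContinuousLinearMap.comp_apply, truncate_ptmul, evalProd_ptmul]
  exact ((f.comp U.1).continuous.tendsto _).comp (h (V.1 u))

end Truncation

section GeneralizedDiagonals

variable {𝕜 : Type*} [RCLike 𝕜] {Y Z : Type*} [NormedAddCommGroup Y] [NormedSpace 𝕜 Y]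
  [FiniteDimensional 𝕜 Y] [NormedAddCommGroup Z] [NormedSpace 𝕜 Z] [FiniteDimensional 𝕜 Z]
  {𝒜 : NonUnitalSubalgebra 𝕜 (Y →L[𝕜] Y)}

theorem isGeneralizedDiagonal_zero [Subsingleton Y] :
    IsGeneralizedDiagonal 𝒜 (0 : ProjTensor 𝕜 (finiteRank 𝕜 Z Y) (finiteRank 𝕜 Y Z)) :=
  ⟨fun _ _ => (map_zero _).trans (map_zero _).symm, fun _ _ => Subsingleton.elim _ _⟩

theorem isGeneralizedDiagonal_of_mem_centralTensors [CompleteSpace Y] {u : Y} {f : StrongDual 𝕜 Y}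
    (hu : f u = 1)
    {Δ : ProjTensor 𝕜 (finiteRank 𝕜 Z Y) (finiteRank 𝕜 Y Z)} (hΔ : Δ ∈ centralTensors 𝕜 Y Z)
    (hτ : evalProd u f Δ = 1) : IsGeneralizedDiagonal 𝒜 Δ := by
  refine ⟨fun W _ => hΔ W, fun W _ => ?_⟩
  rw [prodMap_eq_smul_id_of_mem_centralTensors hu hΔ, hτ, one_smul, ContinuousLinearMap.id_comp]

end GeneralizedDiagonals

section Diagonals

variable {𝕜 : Type*} [RCLike 𝕜] {X : Type*} [NormedAddCommGroup X] [NormedSpace 𝕜 X]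
  {ι : Type*} {l : Filter ι} [l.NeBot] {C : ℝ}

variable {Y : Type*} [NormedAddCommGroup Y] [NormedSpace 𝕜 Y] [FiniteDimensional 𝕜 Y]
  {Z : ι → Type*} [∀ i, NormedAddCommGroup (Z i)] [∀ i, NormedSpace 𝕜 (Z i)]
  [∀ i, FiniteDimensional 𝕜 (Z i)] {S : ∀ i, Z i →L[𝕜] X} {R : ∀ i, X →L[𝕜] Z i}

theorem exists_isGeneralizedDiagonal_of_mem_centralTensors [CompleteSpace Y]
    (hC : ∀ i, ‖S i‖ * ‖R i‖ ≤ C) (hSR : ∀ x, Tendsto (fun i => S i (R i x)) l (𝓝 x))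
    (𝒜 : NonUnitalSubalgebra 𝕜 (Y →L[𝕜] Y)) {u : Y} {f : StrongDual 𝕜 Y} (hu : f u = 1)
    {Δ : ProjTensor 𝕜 (finiteRank 𝕜 X Y) (finiteRank 𝕜 Y X)} (hΔ : Δ ∈ centralTensors 𝕜 Y X)
    (hτ : evalProd u f Δ = 1) :
    ∃ j, ∃ Γ : ProjTensor 𝕜 (finiteRank 𝕜 (Z j) Y) (finiteRank 𝕜 Y (Z j)),
      IsGeneralizedDiagonal 𝒜 Γ ∧ ‖Γ‖ ≤ 2 * (C * ‖Δ‖) := by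
  have hlim := (tendsto_evalProd_truncate hC hSR u f Δ).norm
  rw [hτ, norm_one] at hlim
  obtain ⟨j, hj⟩ := (hlim.eventually_const_le one_half_lt_one).exists
  obtain ⟨Γ, hΓ, hΓτ, hnorm⟩ := exists_mem_apply_eq_one_norm_le
    (V := ProjTensor 𝕜 (finiteRank 𝕜 (Z j) Y) (finiteRank 𝕜 Y (Z j)))
    (truncate_mem_centralTensors (S j) (R j) hΔ) one_half_pos hj
  refine ⟨j, Γ, isGeneralizedDiagonal_of_mem_centralTensors hu hΓ hΓτ, hnorm.trans ?_⟩
  have htruncate : ‖truncate Y (S j) (R j) Δ‖ ≤ C * ‖Δ‖ :=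
    (norm_truncate_apply_le (S j) (R j) Δ).trans
      (mul_le_mul_of_nonneg_right (hC j) (norm_nonneg Δ))
  rw [one_div, inv_inv]
  exact mul_le_mul_of_nonneg_left htruncate zero_le_two

set_option maxSynthPendingDepth 6 in
theorem IsVirtualDiagonal.exists_isGeneralizedDiagonal
    {M : StrongDual 𝕜 (approximable 𝕜 X →L[𝕜] approximable 𝕜 X →L[𝕜] 𝕜)}
    (hM : IsVirtualDiagonal M) (hC : ∀ i, ‖S i‖ * ‖R i‖ ≤ C)
    (hSR : ∀ x, Tendsto (fun i => S i (R i x)) l (𝓝 x)) (𝒜 : NonUnitalSubalgebra 𝕜 (Y →L[𝕜] Y))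
    {S₀ : Y →L[𝕜] X} {R₀ : X →L[𝕜] Y} (hRS : ∀ y, R₀ (S₀ y) = y) :
    ∃ j, ∃ Γ : ProjTensor 𝕜 (finiteRank 𝕜 (Z j) Y) (finiteRank 𝕜 Y (Z j)),
      IsGeneralizedDiagonal 𝒜 Γ ∧ ‖Γ‖ ≤ 2 * (C * (‖M‖ * (‖R₀‖ * ‖S₀‖) + 1)) := by
  obtain ⟨i⟩ : Nonempty ι := l.nonempty_of_neBot
  have hC₀ : 0 ≤ C := (mul_nonneg (norm_nonneg _) (norm_nonneg _)).trans (hC i)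
  have : CompleteSpace Y := FiniteDimensional.complete 𝕜 Y
  rcases subsingleton_or_nontrivial Y with _ | _
  · exact ⟨i, 0, isGeneralizedDiagonal_zero, norm_zero.trans_le (by positivity)⟩
  obtain ⟨u, hu₀⟩ := exists_ne (0 : Y)
  obtain ⟨f, hu⟩ := SeparatingDual.exists_eq_one (R := 𝕜) hu₀
  obtain ⟨Δ, hΔ, hτ, hΔnorm⟩ := hM.exists_mem_centralTensors hRS hu
  obtain ⟨j, Γ, hΓ, hΓnorm⟩ := exists_isGeneralizedDiagonal_of_mem_centralTensors hC hSR 𝒜 hu hΔ hτ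
  exact ⟨j, Γ, hΓ, hΓnorm.trans (mul_le_mul_of_nonneg_left
    (mul_le_mul_of_nonneg_left hΔnorm hC₀) zero_le_two)⟩

set_option maxSynthPendingDepth 6 in
theorem exists_generalizedDiagonals_of_isAmenable [CompleteSpace X] {P : ι → ApproxProj 𝕜 X}
    (hC : ∀ i, ‖(P i).op‖ ≤ C) (hP : ∀ x, Tendsto (fun i => (P i).op x) l (𝓝 x))
    (he : IsBoundedApproxIdentity l fun i => (P i).1) (hA : IsAmenable 𝕜 (approximable 𝕜 X)) :
    ∃ K : ℝ, 0 < K ∧ ∀ i, ∃ j, ∃ Δ : ProjTensor 𝕜 (finiteRank 𝕜 (P j).rg (P i).rg)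
      (finiteRank 𝕜 (P i).rg (P j).rg),
        IsGeneralizedDiagonal (finiteRankAlg 𝕜 (P i).rg) Δ ∧ ‖Δ‖ ≤ K := by
  obtain ⟨M, hM⟩ := hA.exists_isVirtualDiagonal he
  obtain ⟨m, hm⟩ : ∃ m, m = ‖M‖ := ⟨_, rfl⟩
  obtain ⟨i₀⟩ : Nonempty ι := l.nonempty_of_neBot
  have hm₀ : 0 ≤ m := hm ▸ norm_nonneg M
  have hC₀ : 0 ≤ C := (norm_nonneg _).trans (hC i₀)
  have hC' i : ‖(P i).incl‖ * ‖(P i).proj‖ ≤ C := (P i).norm_incl_mul_norm_proj_le.trans (hC i)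
  refine ⟨2 * (C * (m * C + 1)) + 1, by positivity, fun i => ?_⟩
  obtain ⟨j, Γ, hΓ, hnorm⟩ := hM.exists_isGeneralizedDiagonal hC' hP (finiteRankAlg 𝕜 (P i).rg)
    (P i).proj_incl
  rw [← hm, mul_comm ‖(P i).proj‖] at hnorm
  refine ⟨j, Γ, hΓ, hnorm.trans ?_⟩
  calc 2 * (C * (m * (‖(P i).incl‖ * ‖(P i).proj‖) + 1)) ≤ 2 * (C * (m * C + 1)) := by
        have := hC' i
        gcongr
    _ ≤ 2 * (C * (m * C + 1)) + 1 := le_add_of_nonneg_right zero_le_one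

end Diagonals

end

end GenDiag

theorem mainTheorem3 {𝕜 : Type*} [RCLike 𝕜] {X : Type*} [NormedAddCommGroup X]
    [NormedSpace 𝕜 X] [CompleteSpace X]
    {ι : Type*} [Preorder ι] [IsDirectedOrder ι] [Nonempty ι]
    (P : ι → GenDiag.ApproxProj 𝕜 X)
    (hbdd : ∃ C : ℝ, ∀ α, ‖(P α).op‖ ≤ C)
    (hP : ∀ x : X, Filter.Tendsto (fun α => (P α).op x) Filter.atTop (𝓝 x))
    (hP' : ∀ f : StrongDual 𝕜 X,
      Filter.Tendsto (fun α => f.comp (P α).op) Filter.atTop (𝓝 f)) :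
    GenDiag.IsAmenable 𝕜 (GenDiag.approximable 𝕜 X) ↔
      ∃ K : ℝ, 0 < K ∧ ∀ α, ∃ β,
        ∃ Δ : GenDiag.ProjTensor 𝕜 (GenDiag.finiteRank 𝕜 (P β).rg (P α).rg)
            (GenDiag.finiteRank 𝕜 (P α).rg (P β).rg),
          GenDiag.IsGeneralizedDiagonal (GenDiag.finiteRankAlg 𝕜 (P α).rg) Δ ∧ ‖Δ‖ ≤ K := by
  obtain ⟨C, hC⟩ := hbdd
  have he : GenDiag.IsBoundedApproxIdentity atTop fun α => (P α).1 :=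
    GenDiag.isBoundedApproxIdentity_of_tendsto hC hP hP'
  refine ⟨GenDiag.exists_generalizedDiagonals_of_isAmenable hC hP he, ?_⟩
  rintro ⟨K, -, hdiag⟩
  exact GenDiag.isAmenable_of_generalizedDiagonals he hdiag
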